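/- Let $\mathbb K=\mathbb R$ or $\mathbb C$, let $m,n\ge 1$, let $A_1,\dots,A_m$ be symmetric (hermitian) $n\times n$ matrices over $\mathbb K$ and $v_1,\dots,v_m\in\mathbb K^n$. Consider the quadratic map $f:\mathbb K^n\to\mathbb R^m$, $f_i(x)=x^*A_ix-v_i^*x-x^*v_i$, and for $\varepsilon>0$ the ball $B_\varepsilon=\{x\in\mathbb K^n:|x|\le\varepsilon\}$. For $c\in\mathbb R^m$ write $c\cdot A=\sum_i c_iA_i$, $c\cdot v=\sum_i c_iv_i$, let $\lambda_{\min}(M)$ be the smallest eigenvalue of $M$, $\lambda_{\rm m}(M)=\min\{\lambda_{\min}(M),0\}$, and $$\varepsilon_{\max}^2=\lim_{\eta\to0^+}\min_{|c|=1}\bigl|(c\cdot A-\lambda_{\rm m}(c\cdot A)+\eta)^{-1}\,c\cdot v\bigr|^2 ,$$ a limit which exists in $[0,\infty]$. Say that $\varepsilon$ has the boundary property for $(A,v)$ if every $x\in B_\varepsilon$ with $f(x)\in\partial f(B_\varepsilon)$ satisfies $|x|=\varepsilon$, and every $x$ with $|x|<\varepsilon$ is mapped to an interior point of $f(B_\varepsilon)$.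 1. If $0<\varepsilon^2<\varepsilon_{\max}^2$, then $f(B_\varepsilon)$ is strongly convex (for some $\kappa>0$ and all $y,z\in f(B_\varepsilon)$, $t\in[0,1]$, it contains the closed ball of radius $\kappa t(1-t)|y-z|^2$ about $ty+(1-t)z$), its boundary is smooth (near each boundary point the set is a sublevel set $\{\varphi\le 0\}$ of a $C^\infty$ function $\varphi$ with $d\varphi\ne0$), and $\varepsilon$ has the boundary property. Moreover all of this is stable: it remains true, with the same $\varepsilon$, for all symmetric (hermitian) $A_i'$ and all $v_i'$ sufficiently close to $A_i$ and $v_i$. 2. If $0<\varepsilon^2=\varepsilon_{\max}^2$, then $f(B_\varepsilon)$ is strictly convex and $\varepsilon$ has the boundary property. 3. The value $\varepsilon_{\max}^2$ is the largest possible: let $\varepsilon>0$, $\varepsilon^2>\varepsilon_{\max}^2$, and suppose that $\varepsilon$ has the boundary property for $(A,v)$. If $m\ge2$ in the real case, or $m\ge3$ in the complex case, then there are symmetric (hermitian) $A_i'$ and vectors $v_i'$ arbitrarily close to $A_i$, $v_i$ for which the image of $B_\varepsilon$ is not convex. If $m\ge2$ (real or complex), there are such $A_i'$, $v_i'$ for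 which the image of $B_\varepsilon$ is not strictly convex. 4. $\varepsilon_{\max}^2$ improves Polyak's bound: $\varepsilon_P^2\le\varepsilon_{\max}^2$, where $\varepsilon_P^2=\nu^2/(4L^2)$, $\nu^2$ is the smallest eigenvalue of the $m\times m$ matrix $(\operatorname{Re} v_i^*v_j)$ and $L=\max_{|x_1|=|x_2|=1}\bigl(\sum_{i=1}^m(\operatorname{Re}x_1^*A_ix_2)^2\bigr)^{1/2}$ (with $\varepsilon_P^2=\infty$ if $L=0<\nu^2$, and $\varepsilon_P^2=0$ if $\nu=0$). -/

import Mathlib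

open Filter Topology Metric
open scoped ENNReal Matrix ContDiff

noncomputable section

namespace QuadBall

variable {𝕜 : Type*} [RCLike 𝕜] {m n : ℕ}

/-- The quadratic map `f_i(x) = x* A_i x - v_i* x - x* v_i`, as a map `𝕜ⁿ → ℝᵐ` with `𝕜 = ℝ` or `ℂ`.
The right-hand side is a real element of `𝕜` for hermitian `A_i`; see `quadMap_coe`. -/
def quadMap (A : Fin m → Matrix (Fin n) (Fin n) 𝕜) (v : Fin m → EuclideanSpace 𝕜 (Fin n))
    (x : EuclideanSpace 𝕜 (Fin n)) : EuclideanSpace ℝ (Fin m) :=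
  WithLp.toLp 2 fun i =>
    RCLike.re (inner 𝕜 x (Matrix.toEuclideanLin (A i) x) - inner 𝕜 (v i) x - inner 𝕜 x (v i))

theorem quadMap_coe (A : Fin m → Matrix (Fin n) (Fin n) 𝕜) (hA : ∀ i, (A i).IsHermitian)
    (v : Fin m → EuclideanSpace 𝕜 (Fin n)) (x : EuclideanSpace 𝕜 (Fin n)) (i : Fin m) :
    ((quadMap A v x i : ℝ) : 𝕜)
      = inner 𝕜 x (Matrix.toEuclideanLin (A i) x) - inner 𝕜 (v i) x - inner 𝕜 x (v i) := by
  have h1 : starRingEnd 𝕜 (inner 𝕜 x (Matrix.toEuclideanLin (A i) x))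
      = inner 𝕜 x (Matrix.toEuclideanLin (A i) x) := by
    rw [inner_conj_symm]
    exact (Matrix.isSymmetric_toEuclideanLin_iff.2 (hA i)) x x
  refine RCLike.conj_eq_iff_re.1 ?_
  rw [map_sub, map_sub, h1, inner_conj_symm, inner_conj_symm]
  ring

/-- The image `f(B_ε(0))` of the closed ball `B_ε(0) = {x : |x|² ≤ ε²}`. -/
def ballImage (A : Fin m → Matrix (Fin n) (Fin n) 𝕜) (v : Fin m → EuclideanSpace 𝕜 (Fin n))
    (ε : ℝ) : Set (EuclideanSpace ℝ (Fin m)) :=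
  quadMap A v '' closedBall 0 ε

/-- The smallest eigenvalue `λ_min` of a hermitian matrix. -/
def lamMin {k : ℕ} (M : Matrix (Fin k) (Fin k) 𝕜) : ℝ := sInf (spectrum ℝ M)

/-- `λ_m = min(λ_min, 0)`. -/
def lamM {k : ℕ} (M : Matrix (Fin k) (Fin k) 𝕜) : ℝ := min (lamMin M) 0

/-- `c · A = ∑ c_i A_i`. -/
def dotA (A : Fin m → Matrix (Fin n) (Fin n) 𝕜) (c : EuclideanSpace ℝ (Fin m)) :
    Matrix (Fin n) (Fin n) 𝕜 := ∑ i, c i • A i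

/-- `c · v = ∑ c_i v_i`. -/
def dotV (v : Fin m → EuclideanSpace 𝕜 (Fin n)) (c : EuclideanSpace ℝ (Fin m)) :
    EuclideanSpace 𝕜 (Fin n) := ∑ i, c i • v i

/-- `|(c·A - λ_m(c·A) + η)⁻¹ c·v|²`; the matrix is positive definite for `η > 0`. -/
def resolventSq (A : Fin m → Matrix (Fin n) (Fin n) 𝕜) (v : Fin m → EuclideanSpace 𝕜 (Fin n))
    (η : ℝ) (c : EuclideanSpace ℝ (Fin m)) : ℝ :=
  ‖Matrix.toEuclideanLin
    (dotA A c - lamM (dotA A c) • (1 : Matrix (Fin n) (Fin n) 𝕜) + η • 1)⁻¹ (dotV v c)‖ ^ 2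

/-- The minimum of `resolventSq` over the unit sphere `|c|² = 1`. -/
def minResolventSq (A : Fin m → Matrix (Fin n) (Fin n) 𝕜)
    (v : Fin m → EuclideanSpace 𝕜 (Fin n)) (η : ℝ) : ℝ :=
  ⨅ c : sphere (0 : EuclideanSpace ℝ (Fin m)) 1, resolventSq A v η c

/-- `ε²_max`, the limit as `η → 0⁺` of `minResolventSq`, in `[0, ∞]`. -/
def epsMaxSq (A : Fin m → Matrix (Fin n) (Fin n) 𝕜)
    (v : Fin m → EuclideanSpace 𝕜 (Fin n)) : ℝ≥0∞ :=
  limUnder (𝓝[>] (0 : ℝ)) fun η => ENNReal.ofReal (minResolventSq A v η)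

/-- `ν²`, the smallest eigenvalue of the matrix `Re(v_i* v_j)`. -/
def nuSq (v : Fin m → EuclideanSpace 𝕜 (Fin n)) : ℝ :=
  lamMin (Matrix.of fun i j : Fin m => (RCLike.re (inner 𝕜 (v i) (v j)) : ℝ))

/-- `L = max_{|x₁| = |x₂| = 1} (∑_i Re(x₁* A_i x₂)²)^{1/2}`. -/
def lipConst (A : Fin m → Matrix (Fin n) (Fin n) 𝕜) : ℝ :=
  ⨆ p : sphere (0 : EuclideanSpace 𝕜 (Fin n)) 1 × sphere (0 : EuclideanSpace 𝕜 (Fin n)) 1,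
    √(∑ i, (RCLike.re (inner 𝕜 (p.1 : EuclideanSpace 𝕜 (Fin n))
      (Matrix.toEuclideanLin (A i) (p.2 : EuclideanSpace 𝕜 (Fin n))))) ^ 2)

/-- Polyak's bound `ε²_P = ν² / (4 L²)`, in `[0, ∞]` (infinite if `L = 0 < ν²`, zero if `ν² = 0`). -/
def polyakSq (A : Fin m → Matrix (Fin n) (Fin n) 𝕜)
    (v : Fin m → EuclideanSpace 𝕜 (Fin n)) : ℝ≥0∞ :=
  ENNReal.ofReal (nuSq v) / ENNReal.ofReal (4 * lipConst A ^ 2)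

/-- Strong convexity of a set: with some `κ > 0`, for `x, y ∈ S` the set `S` contains the ball of
radius `κ t (1 - t) |x - y|²` about `t x + (1 - t) y`. -/
def StronglyConvexSet {E : Type*} [NormedAddCommGroup E] [NormedSpace ℝ E] (S : Set E) : Prop :=
  ∃ κ : ℝ, 0 < κ ∧ ∀ x ∈ S, ∀ y ∈ S, ∀ t ∈ Set.Icc (0 : ℝ) 1,
    closedBall (t • x + (1 - t) • y) (κ * t * (1 - t) * ‖x - y‖ ^ 2) ⊆ S

/-- The boundary of `S` is smooth: near each of its points, `S` is a sublevel set `{φ ≤ 0}` of a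
`C^∞` function with non-vanishing differential. -/
def HasSmoothBoundary {E : Type*} [NormedAddCommGroup E] [NormedSpace ℝ E] (S : Set E) : Prop :=
  ∀ p ∈ frontier S, ∃ U : Set E, IsOpen U ∧ p ∈ U ∧ ∃ φ : E → ℝ,
    ContDiffOn ℝ ∞ φ U ∧ (∀ y ∈ U, fderiv ℝ φ y ≠ 0) ∧ S ∩ U = {y ∈ U | φ y ≤ 0}

/-- The pre-image in `B_ε(0)` of the boundary of `f(B_ε(0))` lies in the sphere `|x| = ε`, and
interior points of `B_ε(0)` are mapped to interior points of `f(B_ε(0))`. -/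
def BoundaryFromSphere (A : Fin m → Matrix (Fin n) (Fin n) 𝕜)
    (v : Fin m → EuclideanSpace 𝕜 (Fin n)) (ε : ℝ) : Prop :=
  (∀ x ∈ closedBall (0 : EuclideanSpace 𝕜 (Fin n)) ε,
    quadMap A v x ∈ frontier (ballImage A v ε) → x ∈ sphere (0 : EuclideanSpace 𝕜 (Fin n)) ε) ∧
  (∀ x ∈ ball (0 : EuclideanSpace 𝕜 (Fin n)) ε, quadMap A v x ∈ interior (ballImage A v ε))

/-- `P` holds for all tuples of hermitian matrices and vectors sufficiently close to `(A, v)`. -/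
def Stably (P : (Fin m → Matrix (Fin n) (Fin n) 𝕜) → (Fin m → EuclideanSpace 𝕜 (Fin n)) → Prop)
    (A : Fin m → Matrix (Fin n) (Fin n) 𝕜) (v : Fin m → EuclideanSpace 𝕜 (Fin n)) : Prop :=
  ∀ᶠ p in 𝓝 (A, v), (∀ i, (p.1 i).IsHermitian) → P p.1 p.2

end QuadBall

end

/-! Everything is read off from the scalar problems of minimizing c·f over balls, for |c| = 1. Put T
= c·A, w = c·v and let μ = -λ_m(T), the least nonnegative number making T + μ positive semidefinite
(`shift`). A point x with |x| = t and (T + r)x = w for some r ≥ μ minimizes c·f over the ball of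
radius t. Call x degenerate for c if (T + μ)x = w. As long as no degenerate point lies in the open
ball, the minimizer is unique and sits on the sphere (`exists_unique_minimizer`). By compactness
ε_max is the least norm of a degenerate point over all unit c, and ∞ if there is none; so ε² ≤
ε_max² and ε² < ε_max² mean `Admissible` and `StrictlyAdmissible`.

Convexity follows by continuity in the radius (`convex_image_closedBall`): a point of the hull of
f(B_ε) lies, for some t ≤ ε, on a supporting hyperplane of the hull of f(B_t), and such a hyperplane
meets that hull in a single value of f. Below ε_max the multiplier r exceeds μ by a uniform gap
(`exists_gap`). The resulting quadratic growth gives strong convexity, and the inverse function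
theorem for `normalMap`, whose derivative is injective because normals are unique, gives the smooth
boundary. Strict admissibility is an open condition on (A, v), whence stability.

Above ε_max the boundary property excludes μ = 0, so T + μ has a unit kernel vector u and some x₀ ⟂
u inside the ball is degenerate. Then c·f is minimal at all points x₀ + zu with |z|² = ε² - |x₀|²,
and f maps this sphere of 𝕜 by an affine map. A generic small perturbation makes these the only
minimizers and the affine map injective, so the centre of the image is missing and convexity fails.
For strict convexity it is enough that the affine map is not constant. Polyak's bound follows from
|c·v| ≥ ν, ‖c·A‖ ≤ L and μ ≤ L. -/

open scoped RealInnerProductSpace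

namespace QuadBall

/-! ### Minimizing a quadratic function over a ball -/

section TrustRegion

variable {E : Type*} [NormedAddCommGroup E] [InnerProductSpace ℝ E]

/-- The least `μ ≥ 0` for which `T + μ` is positive semidefinite. -/
noncomputable def shift (T : E →L[ℝ] E) : ℝ :=
  max 0 (-sInf ((fun u => ⟪T u, u⟫) '' sphere (0 : E) 1))

theorem shift_nonneg (T : E →L[ℝ] E) : 0 ≤ shift T := le_max_left _ _

theorem continuous_inner_map_self (T : E →L[ℝ] E) : Continuous fun u => ⟪T u, u⟫ := by
  fun_prop

theorem inner_map_smul_self (T : E →L[ℝ] E) (r : ℝ) (x : E) :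
    ⟪T (r • x), r • x⟫ = r ^ 2 * ⟪T x, x⟫ := by
  rw [map_smul, inner_smul_left, inner_smul_right]
  simp only [conj_trivial]
  ring

theorem add_shift_nonneg [FiniteDimensional ℝ E] (T : E →L[ℝ] E) (x : E) :
    0 ≤ ⟪T x, x⟫ + shift T * ‖x‖ ^ 2 := by
  rcases eq_or_ne x 0 with rfl | hx
  · simp
  have hx' : 0 < ‖x‖ := norm_pos_iff.2 hx
  have h1 : sInf ((fun u => ⟪T u, u⟫) '' sphere (0 : E) 1) ≤ ⟪T (‖x‖⁻¹ • x), ‖x‖⁻¹ • x⟫ :=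
    csInf_le ((isCompact_sphere _ _).image (continuous_inner_map_self T)).bddBelow
      ⟨‖x‖⁻¹ • x, by simp [norm_smul, hx'.ne'], rfl⟩
  rw [inner_map_smul_self] at h1
  have h2 : -sInf ((fun u => ⟪T u, u⟫) '' sphere (0 : E) 1) ≤ shift T := le_max_right _ _
  have h3 : 0 ≤ ‖x‖⁻¹ ^ 2 * ⟪T x, x⟫ + shift T := by linarith
  have h4 := mul_nonneg h3 (sq_nonneg ‖x‖)
  have h5 : (‖x‖⁻¹ ^ 2 * ⟪T x, x⟫ + shift T) * ‖x‖ ^ 2 = ⟪T x, x⟫ + shift T * ‖x‖ ^ 2 := by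
    field_simp
  linarith

theorem shift_le [Nontrivial E] {T : E →L[ℝ] E} {μ : ℝ} (hμ : 0 ≤ μ)
    (h : ∀ x, 0 ≤ ⟪T x, x⟫ + μ * ‖x‖ ^ 2) : shift T ≤ μ := by
  refine max_le hμ (neg_le.1 (le_csInf ?_ ?_))
  · exact (NormedSpace.sphere_nonempty.2 zero_le_one).image _
  · rintro _ ⟨u, hu, rfl⟩
    have := h u
    rw [mem_sphere_zero_iff_norm.1 hu] at this
    simp only
    linarith

theorem shift_eq_zero_or [FiniteDimensional ℝ E] [Nontrivial E] (T : E →L[ℝ] E) :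
    shift T = 0 ∨ ∃ u : E, ‖u‖ = 1 ∧ ⟪T u, u⟫ + shift T = 0 := by
  rcases max_choice 0 (-sInf ((fun u => ⟪T u, u⟫) '' sphere (0 : E) 1)) with h | h
  · exact Or.inl h
  · right
    obtain ⟨u, hu, hu'⟩ := ((isCompact_sphere (0 : E) 1).image
      (continuous_inner_map_self T)).sInf_mem ((NormedSpace.sphere_nonempty.2 zero_le_one).image _)
    refine ⟨u, mem_sphere_zero_iff_norm.1 hu, ?_⟩
    have : shift T = _ := h
    rw [this, ← hu']
    simp

theorem shift_eq_of [FiniteDimensional ℝ E] [Nontrivial E] {T : E →L[ℝ] E} {μ : ℝ} (hμ : 0 ≤ μ)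
    (h : ∀ x, 0 ≤ ⟪T x, x⟫ + μ * ‖x‖ ^ 2)
    (h0 : μ = 0 ∨ ∃ u : E, u ≠ 0 ∧ ⟪T u, u⟫ + μ * ‖u‖ ^ 2 = 0) : shift T = μ := by
  refine le_antisymm (shift_le hμ h) ?_
  rcases h0 with rfl | ⟨u, hu, hu'⟩
  · exact shift_nonneg T
  · have h1 := add_shift_nonneg T u
    have h2 : 0 < ‖u‖ ^ 2 := by positivity
    by_contra! h3
    nlinarith

theorem continuous_shift [FiniteDimensional ℝ E] :
    Continuous (shift : (E →L[ℝ] E) → ℝ) := by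
  unfold shift
  refine continuous_const.max (Continuous.neg ?_)
  exact (isCompact_sphere (0 : E) 1).continuous_sInf
    (f := fun (T : E →L[ℝ] E) (u : E) => ⟪T u, u⟫)
    (show Continuous fun p : (E →L[ℝ] E) × E => ⟪p.1 p.2, p.2⟫ by fun_prop)

theorem shift_smul [FiniteDimensional ℝ E] [Nontrivial E] (T : E →L[ℝ] E) {t : ℝ} (ht : 0 ≤ t) :
    shift (t • T) = t * shift T := by
  refine shift_eq_of (mul_nonneg ht (shift_nonneg T)) (fun x => ?_) ?_
  · have := mul_nonneg ht (add_shift_nonneg T x)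
    simp only [smul_apply, inner_smul_left, conj_trivial]
    linarith
  · rcases shift_eq_zero_or T with h | ⟨u, hu, hu'⟩
    · left; simp [h]
    · right
      refine ⟨u, fun h => by simp [h] at hu, ?_⟩
      simp only [smul_apply, inner_smul_left, conj_trivial, hu]
      linear_combination t * hu'

/-- A positive semidefinite symmetric operator vanishes where its quadratic form does. -/
theorem map_eq_zero_of_inner_eq_zero {T : E →L[ℝ] E} (hT : ∀ x y, ⟪T x, y⟫ = ⟪x, T y⟫)
    {μ : ℝ} (h : ∀ x, 0 ≤ ⟪T x, x⟫ + μ * ‖x‖ ^ 2) {u : E} (hu : ⟪T u, u⟫ + μ * ‖u‖ ^ 2 = 0) :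
    T u + μ • u = 0 := by
  set g := T u + μ • u with hg
  -- The form at u + t g, as a polynomial in t, has no constant term and linear coefficient 2|g|²;
  -- being nonnegative for all t forces |g| = 0.
  have key : ∀ t : ℝ, 0 ≤ (⟪T g, g⟫ + μ * ‖g‖ ^ 2) * (t * t) + (2 * ‖g‖ ^ 2) * t + 0 := by
    intro t
    have h1 := h (u + t • g)
    have h2 : ⟪T u, g⟫ = ‖g‖ ^ 2 - μ * ⟪u, g⟫ := by
      have : T u = g - μ • u := by rw [hg]; abel
      rw [this, inner_sub_left, inner_smul_left, real_inner_self_eq_norm_sq]; rfl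
    have h3 : ⟪T g, u⟫ = ⟪T u, g⟫ := by rw [hT, real_inner_comm]
    rw [← real_inner_self_eq_norm_sq] at h1 hu
    simp only [map_add, map_smul, inner_add_left, inner_add_right, inner_smul_left,
      inner_smul_right, conj_trivial, h3, real_inner_comm u g, h2] at h1
    rw [← real_inner_self_eq_norm_sq g] at h1 ⊢
    linear_combination h1 + hu
  have h4 := discrim_le_zero key
  unfold discrim at h4
  have h5 : ‖g‖ ^ 2 = 0 := by nlinarith [sq_nonneg (‖g‖ ^ 2)]
  simpa using h5

/-- Lagrangian identity: the stationarity equation removes the linear term. For r ≥ `shift T` and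
|y| ≤ |x| the right-hand side is nonnegative; all minimality and uniqueness arguments rest on it. -/
theorem quadratic_sub_eq {T : E →L[ℝ] E} (hT : ∀ x y, ⟪T x, y⟫ = ⟪x, T y⟫) {r : ℝ} {x w : E}
    (hx : T x + r • x = w) (y : E) :
    ⟪T y, y⟫ - 2 * ⟪w, y⟫ - (⟪T x, x⟫ - 2 * ⟪w, x⟫)
      = ⟪T (y - x), y - x⟫ + r * ‖y - x‖ ^ 2 + r * (‖x‖ ^ 2 - ‖y‖ ^ 2) := by
  have h3 : ⟪T y, x⟫ = ⟪T x, y⟫ := by rw [hT, real_inner_comm]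
  simp only [← hx, ← real_inner_self_eq_norm_sq, map_sub, inner_sub_left, inner_sub_right,
    inner_add_left, inner_smul_left, conj_trivial, h3, real_inner_comm y x]
  ring

theorem exists_map_add_smul_eq [FiniteDimensional ℝ E] {N : E →L[ℝ] E}
    (hN : ∀ x, 0 ≤ ⟪N x, x⟫) {η : ℝ} (hη : 0 < η) (w : E) : ∃ x, N x + η • x = w := by
  have hinj : Function.Injective (N.toLinearMap + η • LinearMap.id : E →ₗ[ℝ] E) := by
    rw [injective_iff_map_eq_zero]
    intro x hx
    have h1 : ⟪N x + η • x, x⟫ = 0 := by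
      have : N x + η • x = 0 := hx
      rw [this, inner_zero_left]
    rw [inner_add_left, inner_smul_left, real_inner_self_eq_norm_sq, conj_trivial] at h1
    have h2 : ‖x‖ ^ 2 = 0 := by nlinarith [hN x, sq_nonneg ‖x‖]
    simpa using h2
  obtain ⟨x, hx⟩ := LinearMap.injective_iff_surjective.1 hinj w
  exact ⟨x, hx⟩

/-- Pairing N(x - y) = δy with x - y gives |y|² ≤ ⟪y, x⟫. Regularized solutions are thus never
longer than exact ones, and their norm decreases in the regularization parameter. -/
theorem norm_le_of_map_add_smul_eq {N : E →L[ℝ] E} (hN : ∀ x, 0 ≤ ⟪N x, x⟫) {δ : ℝ} (hδ : 0 < δ)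
    {x y : E} (h : N y + δ • y = N x) : ‖y‖ ≤ ‖x‖ := by
  have h1 : N (x - y) = δ • y := by rw [map_sub, ← h]; abel
  have h2 := hN (x - y)
  rw [h1, inner_smul_left, conj_trivial, inner_sub_right, real_inner_self_eq_norm_sq] at h2
  have h3 : ‖y‖ ^ 2 ≤ ⟪y, x⟫ := by nlinarith
  have h4 := real_inner_le_norm y x
  by_contra! h5
  nlinarith [norm_nonneg x, norm_nonneg y]

theorem norm_mul_le_of_map_add_smul_eq {N : E →L[ℝ] E} (hN : ∀ x, 0 ≤ ⟪N x, x⟫) {η : ℝ}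
    {x w : E} (h : N x + η • x = w) : η * ‖x‖ ≤ ‖w‖ := by
  rcases eq_or_ne x 0 with rfl | hx
  · simp
  have h1 : η * ‖x‖ ^ 2 ≤ ⟪w, x⟫ := by
    rw [← h, inner_add_left, inner_smul_left, conj_trivial, real_inner_self_eq_norm_sq]
    linarith [hN x]
  have h2 := real_inner_le_norm w x
  have h3 : 0 < ‖x‖ := norm_pos_iff.2 hx
  by_contra! h5
  nlinarith

/-- The norm of (N + η)⁻¹w is continuous in η and at most |w|/η, so it passes through every value
between |x₀| and 0. -/
theorem exists_norm_eq_of_le [FiniteDimensional ℝ E] {N : E →L[ℝ] E}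
    (hN : ∀ x, 0 ≤ ⟪N x, x⟫) {η₀ : ℝ} (hη₀ : 0 < η₀) {w x₀ : E} (hx₀ : N x₀ + η₀ • x₀ = w) {t : ℝ}
    (ht : 0 < t) (htx : t ≤ ‖x₀‖) : ∃ η, η₀ ≤ η ∧ ∃ x, N x + η • x = w ∧ ‖x‖ = t := by
  have hex : ∀ η, ∃ x, η₀ ≤ η → N x + η • x = w := by
    intro η
    by_cases h : η₀ ≤ η
    · obtain ⟨x, hx⟩ := exists_map_add_smul_eq hN (hη₀.trans_le h) w
      exact ⟨x, fun _ => hx⟩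
    · exact ⟨0, fun h' => absurd h' h⟩
  choose X hX using hex
  have hdiff : ∀ η η', η₀ ≤ η → η₀ ≤ η' → η₀ * ‖X η - X η'‖ ≤ ‖w‖ / η₀ * ‖η - η'‖ := by
    intro η η' h h'
    have e1 : N (X η - X η') + η • (X η - X η') = (η' - η) • X η' := by
      have := (hX η h).trans (hX η' h').symm
      rw [map_sub, smul_sub, sub_smul]
      linear_combination (norm := module) this
    have e2 := norm_mul_le_of_map_add_smul_eq hN e1
    have e3 := norm_mul_le_of_map_add_smul_eq hN (hX η' h')
    have e4 : ‖X η'‖ ≤ ‖w‖ / η₀ := by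
      rw [le_div_iff₀ hη₀]
      nlinarith [norm_nonneg (X η')]
    rw [norm_smul, norm_sub_rev η' η] at e2
    calc η₀ * ‖X η - X η'‖ ≤ η * ‖X η - X η'‖ := by gcongr
      _ ≤ ‖η - η'‖ * ‖X η'‖ := e2
      _ ≤ ‖η - η'‖ * (‖w‖ / η₀) := by gcongr
      _ = _ := mul_comm _ _
  have hcont : ContinuousOn X (Set.Ici η₀) := by
    have : LipschitzOnWith (‖w‖ / η₀ / η₀).toNNReal X (Set.Ici η₀) := by
      refine LipschitzOnWith.of_dist_le_mul fun η h η' h' => ?_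
      rw [dist_eq_norm, dist_eq_norm, Real.coe_toNNReal _ (by positivity)]
      have := hdiff η η' h h'
      rw [div_mul_eq_mul_div, le_div_iff₀ hη₀]
      linarith
    exact this.continuousOn
  -- From |w|/t on, the bound η|x| ≤ |w| gives |x| ≤ t.
  set η₁ := max η₀ (‖w‖ / t)
  have h01 : η₀ ≤ η₁ := le_max_left _ _
  have hle : ‖X η₁‖ ≤ t := by
    have e1 := norm_mul_le_of_map_add_smul_eq hN (hX η₁ h01)
    have e2 : ‖w‖ ≤ η₁ * t := by
      rw [← div_le_iff₀ ht]; exact le_max_right _ _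
    have e3 : 0 < η₁ := hη₀.trans_le h01
    by_contra! h
    nlinarith
  have hx0 : X η₀ = x₀ := by
    have e1 : N (X η₀ - x₀) + η₀ • (X η₀ - x₀) = 0 := by
      have := (hX η₀ le_rfl).trans hx₀.symm
      rw [map_sub, smul_sub]
      linear_combination (norm := module) this
    have e2 := norm_mul_le_of_map_add_smul_eq hN e1
    rw [norm_zero] at e2
    have : ‖X η₀ - x₀‖ = 0 := by
      by_contra h
      have : 0 < ‖X η₀ - x₀‖ := lt_of_le_of_ne (norm_nonneg _) (Ne.symm h)
      nlinarith
    rwa [norm_eq_zero, sub_eq_zero] at this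
  obtain ⟨η, hη, hη'⟩ := intermediate_value_Icc' h01
    ((hcont.mono Set.Icc_subset_Ici_self).norm) ⟨hle, hx0 ▸ htx⟩
  exact ⟨η, hη.1, X η, hX η hη.1, hη'⟩

/-- The limit η → 0 by compactness: the relation is closed in (η, c, x), with c and x in compact
sets. The slack η in the norm bound leaves room for points that only approximate an infimum. -/
theorem exists_solution_of_resolvent {C : Type*} [TopologicalSpace C] [FiniteDimensional ℝ E]
    {S : Set C} (hS : IsCompact S) {N : C → E →L[ℝ] E} (hN : Continuous N) {w : C → E}
    (hw : Continuous w) {ρ : ℝ}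
    (h : ∀ η > 0, ∃ c ∈ S, ∃ x, N c x + η • x = w c ∧ ‖x‖ ≤ ρ + η) :
    ∃ c ∈ S, ∃ x, N c x = w c ∧ ‖x‖ ≤ ρ := by
  by_contra! hcon
  have key : ∀ᶠ η in 𝓝 (0 : ℝ), ∀ p ∈ S ×ˢ closedBall (0 : E) (ρ + 1),
      ¬ (N p.1 p.2 + η • p.2 = w p.1 ∧ ‖p.2‖ ≤ ρ + η) := by
    refine (hS.prod (isCompact_closedBall _ _)).eventually_forall_of_forall_eventually ?_
    rintro ⟨c, x⟩ ⟨hc, -⟩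
    have hclosed : IsClosed {z : ℝ × C × E | N z.2.1 z.2.2 + z.1 • z.2.2 = w z.2.1 ∧
        ‖z.2.2‖ ≤ ρ + z.1} := by
      rw [Set.ofPred_and]
      refine (isClosed_eq ?_ ?_).inter (isClosed_le ?_ ?_)
      · exact ((hN.comp (by fun_prop)).clm_apply (by fun_prop)).add (by fun_prop)
      · exact hw.comp (by fun_prop)
      · fun_prop
      · fun_prop
    refine hclosed.isOpen_compl.mem_nhds ?_
    rintro ⟨h1, h2⟩
    simp only [zero_smul, add_zero] at h1 h2
    exact absurd h2 (not_le.2 (hcon c hc x h1))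
  obtain ⟨δ, hδ, hδ'⟩ := Metric.eventually_nhds_iff.1 key
  -- The cap 1 keeps x in the compact ball of radius ρ + 1.
  have hpos : 0 < min (δ / 2) 1 := by positivity
  obtain ⟨c, hc, x, hx, hx'⟩ := h _ hpos
  refine hδ' (y := min (δ / 2) 1) ?_ (c, x) ⟨hc, ?_⟩ ⟨hx, hx'⟩
  · rw [Real.dist_eq, sub_zero, abs_of_pos hpos]
    exact (min_le_left _ _).trans_lt (by linarith)
  · rw [mem_closedBall_zero_iff]
    exact hx'.trans (by gcongr; exact min_le_right _ _)

theorem psd_add_shift [FiniteDimensional ℝ E] (T : E →L[ℝ] E) (x : E) :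
    0 ≤ ⟪(T + shift T • ContinuousLinearMap.id ℝ E) x, x⟫ := by
  have := add_shift_nonneg T x
  simpa [inner_add_left, inner_smul_left] using this

theorem eq_of_quadratic_le {T : E →L[ℝ] E} (hT : ∀ x y, ⟪T x, y⟫ = ⟪x, T y⟫) {r μ : ℝ}
    (hr : 0 ≤ r) (hμ : ∀ x, 0 ≤ ⟪T x, x⟫ + μ * ‖x‖ ^ 2) (hμr : μ < r) {x y w : E}
    (hx : T x + r • x = w) (hxy : ‖y‖ ≤ ‖x‖)
    (h : ⟪T y, y⟫ - 2 * ⟪w, y⟫ ≤ ⟪T x, x⟫ - 2 * ⟪w, x⟫) : y = x := by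
  have h1 := quadratic_sub_eq hT hx y
  have h2 := hμ (y - x)
  have h3 : 0 ≤ r * (‖x‖ ^ 2 - ‖y‖ ^ 2) :=
    mul_nonneg hr (sub_nonneg.2 (by gcongr))
  have h4 : ‖y - x‖ ^ 2 = 0 := by nlinarith [sq_nonneg ‖y - x‖]
  simpa [sub_eq_zero] using h4

/-- If no solution of `(T + shift T) x = w` lies in the open ball of radius `t`, then the quadratic
function `⟪T y, y⟫ - 2 ⟪w, y⟫` has a unique minimizer on the closed ball, and this minimizer lies
on the sphere. -/
theorem exists_unique_minimizer [FiniteDimensional ℝ E] {T : E →L[ℝ] E}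
    (hT : ∀ x y, ⟪T x, y⟫ = ⟪x, T y⟫) {w : E} {t : ℝ} (ht : 0 < t)
    (h : ∀ x, T x + shift T • x = w → t ≤ ‖x‖) :
    ∃ x, ‖x‖ = t ∧ ∀ y, ‖y‖ ≤ t →
      ⟪T y, y⟫ - 2 * ⟪w, y⟫ ≤ ⟪T x, x⟫ - 2 * ⟪w, x⟫ → y = x := by
  set N := T + shift T • ContinuousLinearMap.id ℝ E
  have hN : ∀ x, 0 ≤ ⟪N x, x⟫ := psd_add_shift T
  have hNx : ∀ x, N x = T x + shift T • x := fun x => rfl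
  by_cases h0 : ∃ x, T x + shift T • x = w ∧ ‖x‖ ≤ t
  · obtain ⟨x, hx, hxt⟩ := h0
    have hxt' : ‖x‖ = t := le_antisymm hxt (h x hx)
    refine ⟨x, hxt', fun y hy hyx => ?_⟩
    have h1 := quadratic_sub_eq hT hx y
    have h2 := add_shift_nonneg T (y - x)
    have h3 : 0 ≤ shift T * (‖x‖ ^ 2 - ‖y‖ ^ 2) :=
      mul_nonneg (shift_nonneg T) (sub_nonneg.2 (by rw [hxt']; gcongr))
    -- A second minimizer y differs from x by a kernel vector of T + `shift T`, so the midpoint is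
    -- again a solution and has norm at least t; the parallelogram law then forces y = x.
    have h4 : T (y - x) + shift T • (y - x) = 0 :=
      map_eq_zero_of_inner_eq_zero hT (add_shift_nonneg T) (by linarith)
    have h5 : T ((2⁻¹ : ℝ) • (x + y)) + shift T • ((2⁻¹ : ℝ) • (x + y)) = w := by
      rw [map_sub, smul_sub] at h4
      rw [map_smul, map_add]
      linear_combination (norm := module) hx + (2⁻¹ : ℝ) • h4
    have h6 := h _ h5
    rw [norm_smul, Real.norm_of_nonneg (by norm_num)] at h6
    have h7 := parallelogram_law_with_norm ℝ x y
    have h8 : ‖x - y‖ * ‖x - y‖ ≤ 0 := by nlinarith [norm_nonneg y, norm_nonneg (x + y)]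
    have h9 : ‖x - y‖ = 0 := by nlinarith [norm_nonneg (x - y)]
    exact (sub_eq_zero.1 (norm_eq_zero.1 h9)).symm
  -- Without a solution in the closed ball some regularized solution has norm at least t, since
  -- otherwise a limit would be such a solution. Increasing η brings the norm down to t, and the
  -- multiplier is then strictly above the shift.
  · have h1 : ∃ η : ℝ, 0 < η ∧ ∃ x, N x + η • x = w ∧ t ≤ ‖x‖ := by
      by_contra! hcon
      apply h0
      obtain ⟨-, -, x, hx, hx'⟩ := exists_solution_of_resolvent (C := Unit) (S := Set.univ)
        isCompact_univ (N := fun _ => N) continuous_const (w := fun _ => w) continuous_const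
        (ρ := t) (fun η hη => by
          obtain ⟨x, hx⟩ := exists_map_add_smul_eq hN hη w
          exact ⟨(), trivial, x, hx, by linarith [hcon η hη x hx]⟩)
      exact ⟨x, hx, hx'⟩
    obtain ⟨η₀, hη₀, x₀, hx₀, htx⟩ := h1
    obtain ⟨η, hη, x, hx, hxt⟩ := exists_norm_eq_of_le hN hη₀ hx₀ ht htx
    refine ⟨x, hxt, fun y hy hyx => ?_⟩
    refine eq_of_quadratic_le hT (r := shift T + η) (μ := shift T) (by
      have := shift_nonneg T; linarith) (add_shift_nonneg T) (by linarith) (w := w) ?_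
      (hxt.symm ▸ hy) hyx
    rw [← hx, hNx, add_smul, add_assoc]

end TrustRegion

/-! ### Convexity of images from unique minimizers of linear functionals -/

section ConvexGeometry

variable {E V : Type*} [NormedAddCommGroup E] [InnerProductSpace ℝ E]
  [NormedAddCommGroup V] [InnerProductSpace ℝ V]

/-- On the compact set F one has |z - p| ≤ δ + D(⟪c, z⟫ - ⟪c, p⟫) with D depending on δ. This
inequality is closed and convex in z, so it passes to the closed hull, where at y it gives |y - p| ≤
δ. -/
theorem eq_of_mem_closure_convexHull {F : Set V} (hF : IsCompact F) {c p : V}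
    (h : ∀ z ∈ F, ⟪c, z⟫ ≤ ⟪c, p⟫ → z = p) {y : V} (hy : y ∈ closure (convexHull ℝ F))
    (hyp : ⟪c, y⟫ ≤ ⟪c, p⟫) : y = p := by
  suffices hδ : ∀ δ > 0, ‖y - p‖ ≤ δ by
    have := le_of_forall_pos_le_add (b := 0) fun δ hδ' => (hδ δ hδ').trans_eq (zero_add δ).symm
    exact sub_eq_zero.1 (norm_le_zero_iff.1 this)
  intro δ hδ
  obtain ⟨C, hC⟩ : BddAbove ((fun z => ‖z - p‖ / (⟪c, z⟫ - ⟪c, p⟫)) '' (F ∩ {z | δ ≤ ‖z - p‖})) := by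
    refine IsCompact.bddAbove_image (hF.inter_right (isClosed_le (by fun_prop) (by fun_prop))) ?_
    refine ContinuousOn.div (by fun_prop) (by fun_prop) ?_
    rintro z ⟨hz, hzδ⟩ h0
    have hzp := h z hz (by linarith)
    rw [Set.mem_ofPred_eq, hzp, sub_self, norm_zero] at hzδ
    linarith
  set D := max C 0
  have hsub : closure (convexHull ℝ F) ⊆ {y | ‖y - p‖ ≤ δ + D * (⟪c, y⟫ - ⟪c, p⟫)} := by
    refine closure_minimal (convexHull_min ?_ ?_) (isClosed_le (by fun_prop) (by fun_prop))
    · intro z hz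
      rcases le_or_gt ⟪c, z⟫ ⟪c, p⟫ with hle | hlt
      · simp [h z hz hle, hδ.le]
      · have hD : 0 ≤ D * (⟪c, z⟫ - ⟪c, p⟫) :=
          mul_nonneg (le_max_right _ _) (sub_nonneg.2 hlt.le)
        rcases le_total ‖z - p‖ δ with hz' | hz'
        · simp only [Set.mem_ofPred_eq]; linarith
        · have h1 : ‖z - p‖ / (⟪c, z⟫ - ⟪c, p⟫) ≤ D :=
            (hC ⟨z, ⟨hz, hz'⟩, rfl⟩).trans (le_max_left _ _)
          rw [div_le_iff₀ (sub_pos.2 hlt)] at h1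
          simp only [Set.mem_ofPred_eq]; linarith
    · intro x hx z hz a b ha hb hab
      simp only [Set.mem_ofPred_eq] at hx hz ⊢
      have e : a • x + b • z - p = a • (x - p) + b • (z - p) := by
        have : p = (a + b) • p := by rw [hab, one_smul]
        rw [smul_sub, smul_sub]
        nth_rewrite 1 [this]
        module
      rw [e, inner_add_right, inner_smul_right, inner_smul_right]
      have h1 := norm_add_le (a • (x - p)) (b • (z - p))
      rw [norm_smul, norm_smul, Real.norm_of_nonneg ha, Real.norm_of_nonneg hb] at h1
      have h2 := mul_le_mul_of_nonneg_left hx ha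
      have h3 := mul_le_mul_of_nonneg_left hz hb
      have hb' : b = 1 - a := by linarith
      subst hb'
      linarith
  have h1 := hsub hy
  have h2 : D * (⟪c, y⟫ - ⟪c, p⟫) ≤ 0 :=
    mul_nonpos_of_nonneg_of_nonpos (le_max_right _ _) (by linarith)
  simp only [Set.mem_ofPred_eq] at h1
  linarith

variable [FiniteDimensional ℝ V] [Nontrivial V]

theorem mem_of_forall_unit_inner_le {F : Set V} (hF : IsClosed F) (hF' : Convex ℝ F) {y : V}
    (h : ∀ c : V, ‖c‖ = 1 → ∃ z ∈ F, ⟪c, z⟫ ≤ ⟪c, y⟫) : y ∈ F := by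
  by_contra hy
  obtain ⟨l, a, hla, hlF⟩ := geometric_hahn_banach_point_closed hF' hF hy
  obtain ⟨c, hc⟩ : ∃ c : V, ∀ z, l z = ⟪c, z⟫ :=
    ⟨(InnerProductSpace.toDual ℝ V).symm l, fun z => by simp⟩
  have hc0 : c ≠ 0 := by
    rintro rfl
    obtain ⟨e, he⟩ := exists_norm_eq V zero_le_one
    obtain ⟨z, hz, -⟩ := h e he
    have := hlF z hz
    rw [hc, inner_zero_left] at this hla
    linarith
  have hcpos : 0 < ‖c‖ := norm_pos_iff.2 hc0
  obtain ⟨z, hz, hz'⟩ := h (‖c‖⁻¹ • c) (by simp [norm_smul, hcpos.ne'])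
  rw [inner_smul_left, inner_smul_left, conj_trivial] at hz'
  have h1 := le_of_mul_le_mul_left hz' (inv_pos.2 hcpos)
  have h2 := hlF z hz
  rw [hc] at h2 hla
  linarith

/-- Strict inequality is open in (c, y), so by compactness of the unit sphere the separation
criterion holds for all nearby points. -/
theorem mem_interior_of_forall_unit_inner_lt {F : Set V} (hF : IsClosed F) (hF' : Convex ℝ F)
    {y : V} (h : ∀ c : V, ‖c‖ = 1 → ∃ z ∈ F, ⟪c, z⟫ < ⟪c, y⟫) : y ∈ interior F := by
  have key : ∀ᶠ y' in 𝓝 y, ∀ c ∈ sphere (0 : V) 1, ∃ z ∈ F, ⟪c, z⟫ < ⟪c, y'⟫ := by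
    refine (isCompact_sphere (0 : V) 1).eventually_forall_of_forall_eventually fun c hc => ?_
    obtain ⟨z, hz, hz'⟩ := h c (mem_sphere_zero_iff_norm.1 hc)
    have hopen : IsOpen {p : V × V | ⟪p.2, z⟫ < ⟪p.2, p.1⟫} :=
      isOpen_lt (by fun_prop) (by fun_prop)
    filter_upwards [hopen.mem_nhds hz'] with p hp using ⟨z, hz, hp⟩
  rw [mem_interior_iff_mem_nhds]
  filter_upwards [key] with y' hy'
  refine mem_of_forall_unit_inner_le hF hF' fun c hc => ?_
  obtain ⟨z, hz, hz'⟩ := hy' c (mem_sphere_zero_iff_norm.2 hc)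
  exact ⟨z, hz, hz'.le⟩

/-- If on each ball of radius `t ≤ ε` all linear functionals of `f` attain their minimum at a
single value of `f`, then the image of the ball of radius `ε` is convex. -/
theorem convex_image_closedBall [FiniteDimensional ℝ E] {f : E → V} (hf : Continuous f)
    (hf0 : f 0 = 0) {ε : ℝ} (hε : 0 < ε)
    (h : ∀ t, 0 < t → t ≤ ε → ∀ c : V, ‖c‖ = 1 → ∃ x, ‖x‖ ≤ t ∧
      ∀ y, ‖y‖ ≤ t → ⟪c, f y⟫ ≤ ⟪c, f x⟫ → f y = f x) :
    Convex ℝ (f '' closedBall 0 ε) := by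
  suffices hsub : convexHull ℝ (f '' closedBall 0 ε) ⊆ f '' closedBall 0 ε by
    rw [← hsub.antisymm (subset_convexHull ℝ _)]
    exact convex_convexHull ℝ _
  intro y₀ hy₀
  -- The minimum of ⟪c, f⟫ over the ball of radius t, taken over the unit ball after rescaling so
  -- that it is jointly continuous in (t, c).
  set g : ℝ × V → ℝ := fun p => sInf ((fun u => ⟪p.2, f (p.1 • u)⟫) '' closedBall (0 : E) 1)
  have hg : Continuous g := (isCompact_closedBall (0 : E) 1).continuous_sInf
    (f := fun (p : ℝ × V) u => ⟪p.2, f (p.1 • u)⟫)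
    (show Continuous fun q : (ℝ × V) × E => ⟪q.1.2, f (q.1.1 • q.2)⟫ by fun_prop)
  have hcpt : ∀ p : ℝ × V, IsCompact ((fun u => ⟪p.2, f (p.1 • u)⟫) '' closedBall (0 : E) 1) :=
    fun p => (isCompact_closedBall _ _).image (by fun_prop)
  have hgle : ∀ t, 0 ≤ t → ∀ c y, ‖y‖ ≤ t → g (t, c) ≤ ⟪c, f y⟫ := by
    intro t ht c y hy
    refine csInf_le (hcpt (t, c)).bddBelow ⟨t⁻¹ • y, ?_, ?_⟩
    · rw [mem_closedBall_zero_iff, norm_smul, norm_inv, Real.norm_of_nonneg ht]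
      exact inv_mul_le_one_of_le₀ hy ht
    · rcases ht.eq_or_lt with rfl | ht'
      · have : y = 0 := norm_le_zero_iff.1 hy
        simp [this]
      · simp [smul_smul, ht'.ne']
  have hgmem : ∀ t, 0 ≤ t → ∀ c, ∃ y, ‖y‖ ≤ t ∧ g (t, c) = ⟪c, f y⟫ := by
    intro t ht c
    obtain ⟨u, hu, hu'⟩ := (hcpt (t, c)).sInf_mem ⟨_, 0, by simp, rfl⟩
    refine ⟨t • u, ?_, hu'.symm⟩
    rw [norm_smul, Real.norm_of_nonneg ht]
    exact mul_le_of_le_one_right ht (mem_closedBall_zero_iff.1 hu)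
  -- H(t) ≥ 0 says that y₀ lies in the closed hull of the image of the ball of radius t; a zero of H
  -- is a radius at which y₀ lies on a supporting hyperplane of that hull.
  set H : ℝ → ℝ := fun t => sInf ((fun c => ⟪c, y₀⟫ - g (t, c)) '' sphere (0 : V) 1)
  have hH : Continuous H := (isCompact_sphere (0 : V) 1).continuous_sInf
    (f := fun (t : ℝ) c => ⟪c, y₀⟫ - g (t, c))
    (show Continuous fun q : ℝ × V => ⟪q.2, y₀⟫ - g (q.1, q.2) by fun_prop)
  have hcptH : ∀ t : ℝ, IsCompact ((fun c => ⟪c, y₀⟫ - g (t, c)) '' sphere (0 : V) 1) :=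
    fun t => (isCompact_sphere _ _).image (by fun_prop)
  have hneH : ∀ t : ℝ, ((fun c => ⟪c, y₀⟫ - g (t, c)) '' sphere (0 : V) 1).Nonempty :=
    fun t => (NormedSpace.sphere_nonempty.2 zero_le_one).image _
  have hHε : 0 ≤ H ε := by
    refine le_csInf (hneH ε) ?_
    rintro _ ⟨c, -, rfl⟩
    have hsub : convexHull ℝ (f '' closedBall 0 ε) ⊆ {y | g (ε, c) ≤ ⟪c, y⟫} := by
      refine convexHull_min ?_ (convex_halfSpace_ge (innerₛₗ ℝ c).isLinear _)
      rintro _ ⟨y, hy, rfl⟩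
      exact hgle ε hε.le c y (mem_closedBall_zero_iff.1 hy)
    exact sub_nonneg.2 (hsub hy₀)
  have hH0 : H 0 ≤ 0 := by
    obtain ⟨e, he, he'⟩ : ∃ e : V, ‖e‖ = 1 ∧ ⟪e, y₀⟫ ≤ 0 := by
      obtain ⟨e, he⟩ := exists_norm_eq V zero_le_one
      rcases le_total ⟪e, y₀⟫ 0 with h' | h'
      · exact ⟨e, he, h'⟩
      · exact ⟨-e, by rwa [norm_neg], by rw [inner_neg_left]; linarith⟩
    obtain ⟨y, hy, hy'⟩ := hgmem 0 le_rfl e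
    rw [norm_le_zero_iff.1 hy, hf0, inner_zero_right] at hy'
    calc H 0 ≤ ⟪e, y₀⟫ - g (0, e) :=
          csInf_le (hcptH 0).bddBelow ⟨e, mem_sphere_zero_iff_norm.2 he, rfl⟩
      _ ≤ 0 := by rw [hy']; linarith
  obtain ⟨t, ⟨ht0, htε⟩, hHt⟩ := intermediate_value_Icc hε.le hH.continuousOn ⟨hH0, hHε⟩
  have h' : ∀ c : V, ‖c‖ = 1 → ∃ x, ‖x‖ ≤ t ∧
      ∀ y, ‖y‖ ≤ t → ⟪c, f y⟫ ≤ ⟪c, f x⟫ → f y = f x := by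
    intro c hc
    rcases ht0.eq_or_lt with rfl | ht0'
    · exact ⟨0, by simp, fun y hy _ => by rw [norm_le_zero_iff.1 hy]⟩
    · exact h t ht0' htε c hc
  obtain ⟨c, hc, hc'⟩ := (hcptH t).sInf_mem (hneH t)
  have hcy : ⟪c, y₀⟫ = g (t, c) := sub_eq_zero.1 (hc'.trans hHt)
  obtain ⟨x, hx, hxmin⟩ := h' c (mem_sphere_zero_iff_norm.1 hc)
  have hy₀t : y₀ ∈ closure (convexHull ℝ (f '' closedBall 0 t)) := by
    refine mem_of_forall_unit_inner_le isClosed_closure (convex_convexHull ℝ _).closure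
      fun d hd => ?_
    obtain ⟨y, hy, hy'⟩ := hgmem t ht0 d
    refine ⟨f y, subset_closure (subset_convexHull ℝ _ ⟨y, mem_closedBall_zero_iff.2 hy, rfl⟩), ?_⟩
    have : H t ≤ ⟪d, y₀⟫ - g (t, d) :=
      csInf_le (hcptH t).bddBelow ⟨d, mem_sphere_zero_iff_norm.2 hd, rfl⟩
    rw [← hy']
    linarith
  refine ⟨x, mem_closedBall_zero_iff.2 (hx.trans htε), Eq.symm ?_⟩
  refine eq_of_mem_closure_convexHull ((isCompact_closedBall (0 : E) t).image hf) (c := c) ?_ hy₀t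
    (hcy.trans_le (hgle t ht0 c x hx))
  rintro _ ⟨y, hy, rfl⟩ hyx
  exact hxmin y (mem_closedBall_zero_iff.1 hy) hyx

/-- A point of the image outside its interior minimizes some functional c, and c has a unique
minimizer, which is on the sphere. A segment through a non-interior point would have both ends
minimizing c. -/
theorem strictConvex_image_closedBall [FiniteDimensional ℝ E] {f : E → V} (hf : Continuous f)
    (hf0 : f 0 = 0) {ε : ℝ} (hε : 0 < ε)
    (h : ∀ t, 0 < t → t ≤ ε → ∀ c : V, ‖c‖ = 1 → ∃ x, ‖x‖ = t ∧
      ∀ y, ‖y‖ ≤ t → ⟪c, f y⟫ ≤ ⟪c, f x⟫ → y = x) :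
    StrictConvex ℝ (f '' closedBall 0 ε) ∧
      ∀ x, ‖x‖ ≤ ε → f x ∉ interior (f '' closedBall 0 ε) → ‖x‖ = ε := by
  have hconv : Convex ℝ (f '' closedBall 0 ε) :=
    convex_image_closedBall hf hf0 hε fun t ht ht' c hc => by
      obtain ⟨x, hx, hx'⟩ := h t ht ht' c hc
      exact ⟨x, hx.le, fun y hy hyx => by rw [hx' y hy hyx]⟩
  have hclosed : IsClosed (f '' closedBall (0 : E) ε) :=
    ((isCompact_closedBall _ _).image hf).isClosed
  have hsupp : ∀ y, y ∉ interior (f '' closedBall (0 : E) ε) → ∃ c : V, ‖c‖ = 1 ∧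
      ∀ z ∈ f '' closedBall (0 : E) ε, ⟪c, y⟫ ≤ ⟪c, z⟫ := by
    intro y hy
    by_contra! hcon
    exact hy (mem_interior_of_forall_unit_inner_lt hclosed hconv hcon)
  constructor
  · rintro _ ⟨x, hx, rfl⟩ _ ⟨y, hy, rfl⟩ hxy a b ha hb hab
    by_contra hz
    obtain ⟨c, hc, hcz⟩ := hsupp _ hz
    obtain ⟨p, hp, hp'⟩ := h ε hε le_rfl c hc
    have h1 := hcz _ ⟨x, hx, rfl⟩
    have h2 := hcz _ ⟨y, hy, rfl⟩
    have h3 := hcz _ ⟨p, mem_closedBall_zero_iff.2 hp.le, rfl⟩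
    rw [inner_add_right, inner_smul_right, inner_smul_right] at h1 h2 h3
    have ha' : a = 1 - b := by linarith
    subst ha'
    have h4 : ⟪c, f x⟫ = ⟪c, f y⟫ := by
      refine le_antisymm ?_ ?_
      · refine le_of_mul_le_mul_left ?_ ha
        linarith
      · refine le_of_mul_le_mul_left ?_ hb
        linarith
    rw [h4] at h3
    apply hxy
    rw [hp' x (mem_closedBall_zero_iff.1 hx) (by linarith),
      hp' y (mem_closedBall_zero_iff.1 hy) (by linarith)]
  · intro x hx hfx
    obtain ⟨c, hc, hcz⟩ := hsupp _ hfx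
    obtain ⟨p, hp, hp'⟩ := h ε hε le_rfl c hc
    rw [hp' x hx (hcz _ ⟨p, mem_closedBall_zero_iff.2 hp.le, rfl⟩), hp]

end ConvexGeometry

/-! ### Quadratic maps with operator-valued coefficients: strict and strong convexity -/

/-- A quadratic map `f : E → V` given through `⟪c, f x⟫ = ⟪T_c x, x⟫ - 2 ⟪w_c, x⟫` with symmetric
operators `T_c`. -/
structure QuadFamily (E V : Type*) [NormedAddCommGroup E] [InnerProductSpace ℝ E]
    [NormedAddCommGroup V] [InnerProductSpace ℝ V] where
  /-- the operators of the quadratic part -/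
  T : V →L[ℝ] E →L[ℝ] E
  /-- the vectors of the linear part -/
  w : V →L[ℝ] E
  /-- the quadratic map -/
  f : E → V
  symm : ∀ c x y, ⟪T c x, y⟫ = ⟪x, T c y⟫
  inner_f : ∀ c x, ⟪c, f x⟫ = ⟪T c x, x⟫ - 2 * ⟪w c, x⟫
  contDiff : ContDiff ℝ ω f

namespace QuadFamily

variable {E V : Type*} [NormedAddCommGroup E] [InnerProductSpace ℝ E]
  [NormedAddCommGroup V] [InnerProductSpace ℝ V] (Q : QuadFamily E V)

/-- No degenerate critical point `(T_c + shift T_c) x = w_c` lies in the open ball. -/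
def Admissible (ε : ℝ) : Prop :=
  ∀ c : V, ‖c‖ = 1 → ∀ x, Q.T c x + shift (Q.T c) • x = Q.w c → ε ≤ ‖x‖

/-- No degenerate critical point `(T_c + shift T_c) x = w_c` lies in the closed ball. -/
def StrictlyAdmissible (ε : ℝ) : Prop :=
  ∀ c : V, ‖c‖ = 1 → ∀ x, Q.T c x + shift (Q.T c) • x = Q.w c → ε < ‖x‖

variable {Q}

theorem StrictlyAdmissible.admissible {ε : ℝ} (h : Q.StrictlyAdmissible ε) : Q.Admissible ε :=
  fun c hc x hx => (h c hc x hx).le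

theorem f_zero : Q.f 0 = 0 := by
  refine ext_inner_left ℝ fun c => ?_
  rw [Q.inner_f]
  simp

theorem inner_sub_eq {c : V} {r : ℝ} {x : E} (hx : Q.T c x + r • x = Q.w c) (y : E) :
    ⟪c, Q.f y⟫ - ⟪c, Q.f x⟫
      = ⟪Q.T c (y - x), y - x⟫ + r * ‖y - x‖ ^ 2 + r * (‖x‖ ^ 2 - ‖y‖ ^ 2) := by
  rw [Q.inner_f, Q.inner_f, quadratic_sub_eq (Q.symm c) hx]

theorem inner_fderiv (c : V) (x y : E) :
    ⟪c, fderiv ℝ Q.f x y⟫ = 2 * ⟪Q.T c x - Q.w c, y⟫ := by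
  have h1 : HasFDerivAt Q.f (fderiv ℝ Q.f x) x :=
    (Q.contDiff.differentiable (by simp) x).hasFDerivAt
  have h2 : HasFDerivAt (fun z => ⟪c, Q.f z⟫) ((innerSL ℝ c).comp (fderiv ℝ Q.f x)) x :=
    (innerSL ℝ c).hasFDerivAt.comp x h1
  have h3 := (((Q.T c).hasFDerivAt (x := x)).inner ℝ (hasFDerivAt_id x)).sub
    (((innerSL ℝ (Q.w c)).hasFDerivAt (x := x)).const_mul 2)
  replace h3 := h3.congr_of_eventuallyEq (f₁ := fun z => ⟪c, Q.f z⟫)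
    (Eventually.of_forall fun z => Q.inner_f c z)
  have h4 := congrArg (fun L : E →L[ℝ] ℝ => L y) (h2.unique h3)
  simp only [ContinuousLinearMap.comp_apply, innerSL_apply_apply] at h4
  rw [h4, inner_sub_left]
  simp [Q.symm c x y, real_inner_comm]
  ring

variable [FiniteDimensional ℝ E]

/-- The excess η of the multiplier over the shift becomes quadratic growth at the minimizer, the
source of strong convexity. -/
theorem inner_add_le {c : V} {r η : ℝ} {x : E} (hx : Q.T c x + r • x = Q.w c)
    (hη : shift (Q.T c) + η ≤ r) (hη0 : 0 ≤ η) {y : E} (hy : ‖y‖ ≤ ‖x‖) :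
    ⟪c, Q.f x⟫ + η * ‖y - x‖ ^ 2 ≤ ⟪c, Q.f y⟫ := by
  have h1 := inner_sub_eq hx y
  have h2 := add_shift_nonneg (Q.T c) (y - x)
  have h3 : 0 ≤ r * (‖x‖ ^ 2 - ‖y‖ ^ 2) :=
    mul_nonneg (by linarith [shift_nonneg (Q.T c)]) (sub_nonneg.2 (by gcongr))
  nlinarith [sq_nonneg ‖y - x‖]

theorem inner_le {c : V} {r η : ℝ} {x : E} (hx : Q.T c x + r • x = Q.w c)
    (hη : shift (Q.T c) + η ≤ r) (hη0 : 0 ≤ η) {y : E} (hy : ‖y‖ ≤ ‖x‖) :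
    ⟪c, Q.f x⟫ ≤ ⟪c, Q.f y⟫ := by
  have := inner_add_le hx hη hη0 hy
  nlinarith [sq_nonneg ‖y - x‖]

theorem eq_of_inner_le {c : V} {r η : ℝ} {x : E} (hx : Q.T c x + r • x = Q.w c)
    (hη : shift (Q.T c) + η ≤ r) (hη0 : 0 < η) {y : E} (hy : ‖y‖ ≤ ‖x‖)
    (h : ⟪c, Q.f y⟫ ≤ ⟪c, Q.f x⟫) : y = x := by
  have := inner_add_le hx hη hη0.le hy
  have h2 : ‖y - x‖ ^ 2 = 0 := by nlinarith [sq_nonneg ‖y - x‖]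
  simpa [sub_eq_zero] using h2

theorem StrictlyAdmissible.lt_norm [Nontrivial E] {ε : ℝ} (h : Q.StrictlyAdmissible ε) {c : V} (hc : c ≠ 0)
    {x : E} (hx : Q.T c x + shift (Q.T c) • x = Q.w c) : ε < ‖x‖ := by
  have hcpos : 0 < ‖c‖ := norm_pos_iff.2 hc
  refine h (‖c‖⁻¹ • c) (by simp [norm_smul, hcpos.ne']) x ?_
  rw [map_smul, shift_smul _ (inv_nonneg.2 hcpos.le), map_smul, ← hx, smul_apply,
    mul_smul, smul_add]

/-- The image of the ball has a unique supporting half-space at each of its boundary points. -/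
theorem StrictlyAdmissible.eq_smul_of_normal [Nontrivial E] {ε : ℝ} (h : Q.StrictlyAdmissible ε) {c d : V}
    {r s : ℝ} {x : E} (hxε : ‖x‖ ≤ ε) (hr : shift (Q.T c) < r) (hc : Q.T c x + r • x = Q.w c)
    (hd : Q.T d x + s • x = Q.w d) : d = (s / r) • c := by
  have hrpos : 0 < r := (shift_nonneg _).trans_lt hr
  by_contra hne
  -- This combination cancels the multipliers, so x solves the equation of c + τe with the same r
  -- for every τ.
  set e := d - (s / r) • c with he
  have he0 : e ≠ 0 := sub_ne_zero.2 hne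
  have hex : Q.T e x = Q.w e := by
    have h1 : Q.T d x = Q.w d - s • x := by rw [← hd]; abel
    have h2 : Q.T c x = Q.w c - r • x := by rw [← hc]; abel
    rw [he, map_sub, map_sub, map_smul, map_smul, sub_apply, smul_apply, h1, h2, smul_sub,
      smul_smul, div_mul_cancel₀ s hrpos.ne']
    abel
  -- If the shift along c + τe reached r, then x would be a degenerate point in the closed ball.
  have hτ : ∀ τ : ℝ, 0 ≤ τ → shift (Q.T (c + τ • e)) < r := by
    intro τ hτ
    by_contra! hle
    have hcont : Continuous fun τ : ℝ => shift (Q.T (c + τ • e)) :=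
      continuous_shift.comp (Q.T.continuous.comp (by fun_prop))
    obtain ⟨τ', -, hτ'⟩ := intermediate_value_Icc hτ hcont.continuousOn
      ⟨by simpa using hr.le, hle⟩
    have hne0 : c + τ' • e ≠ 0 := by
      intro h0
      have hz : shift (0 : E →L[ℝ] E) = 0 := by
        simpa using shift_smul (0 : E →L[ℝ] E) le_rfl
      simp only [h0, map_zero, hz] at hτ'
      exact hrpos.ne hτ'
    refine absurd hxε (not_le.2 (h.lt_norm hne0 ?_))
    simp only at hτ'
    rw [hτ', map_add, map_add, map_smul, map_smul, add_apply, smul_apply, hex, ← hc]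
    abel
  -- As the form of T_c + τT_e + r stays nonnegative for all τ ≥ 0, T_e is positive semidefinite.
  -- Then its shift is 0 and x is degenerate for e, a contradiction. The τ used below makes the form
  -- at most -1 wherever T_e would be negative.
  have hpos : ∀ y, 0 ≤ ⟪Q.T e y, y⟫ + 0 * ‖y‖ ^ 2 := by
    intro y
    by_contra! hneg
    rw [zero_mul, add_zero] at hneg
    set a := ⟪Q.T c y, y⟫ + r * ‖y‖ ^ 2 with ha
    have hb : 0 ≤ (|a| + 1) / -⟪Q.T e y, y⟫ := div_nonneg (by positivity) (by linarith)
    have h1 := add_shift_nonneg (Q.T (c + ((|a| + 1) / -⟪Q.T e y, y⟫) • e)) y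
    have h2 := (hτ _ hb).le
    rw [map_add, map_smul] at h1 h2
    rw [add_apply, smul_apply, inner_add_left, inner_smul_left, conj_trivial, div_neg, neg_mul,
      div_mul_cancel₀ _ hneg.ne, ← div_neg] at h1
    have h3 := mul_le_mul_of_nonneg_right h2 (sq_nonneg ‖y‖)
    have h4 := le_abs_self a
    linarith
  have hshift : shift (Q.T e) = 0 := shift_eq_of le_rfl hpos (Or.inl rfl)
  refine absurd hxε (not_le.2 (h.lt_norm he0 ?_))
  rw [hshift, zero_smul, add_zero, hex]

variable [FiniteDimensional ℝ V]

/-- If for every η some c had a regularized solution shorter than ε, the limit would be a degenerate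
point in the closed ball. With one η valid for all c, further regularization shrinks the norm to
exactly ε. -/
theorem StrictlyAdmissible.exists_gap {ε : ℝ} (hε : 0 < ε) (h : Q.StrictlyAdmissible ε) :
    ∃ η > 0, ∀ c : V, ‖c‖ = 1 → ∃ r x, shift (Q.T c) + η ≤ r ∧ Q.T c x + r • x = Q.w c ∧
      ‖x‖ = ε := by
  have h1 : ∃ η : ℝ, 0 < η ∧ ∀ c ∈ sphere (0 : V) 1, ∀ x,
      (Q.T c + shift (Q.T c) • ContinuousLinearMap.id ℝ E) x + η • x = Q.w c → ε ≤ ‖x‖ := by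
    by_contra! hcon
    obtain ⟨c, hc, x, hx, hx'⟩ := exists_solution_of_resolvent (isCompact_sphere (0 : V) 1)
      (N := fun c => Q.T c + shift (Q.T c) • ContinuousLinearMap.id ℝ E)
      (Q.T.continuous.add ((continuous_shift.comp Q.T.continuous).smul continuous_const))
      Q.w.continuous (ρ := ε) (fun η hη => by
        obtain ⟨c, hc, x, hx, hx'⟩ := hcon η hη
        exact ⟨c, hc, x, hx, by linarith⟩)
    exact absurd hx' (not_le.2 (h c (mem_sphere_zero_iff_norm.1 hc) x hx))
  obtain ⟨η, hη, h1⟩ := h1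
  refine ⟨η, hη, fun c hc => ?_⟩
  obtain ⟨x₀, hx₀⟩ := exists_map_add_smul_eq (psd_add_shift (Q.T c)) hη (Q.w c)
  obtain ⟨η', hη', x, hx, hxε⟩ := exists_norm_eq_of_le (psd_add_shift (Q.T c)) hη hx₀ hε
    (h1 c (mem_sphere_zero_iff_norm.2 hc) x₀ hx₀)
  refine ⟨shift (Q.T c) + η', x, by linarith, ?_, hxε⟩
  rw [← hx, add_smul, ← add_assoc]
  rfl

variable [Nontrivial V]

theorem Admissible.strictConvex {ε : ℝ} (hε : 0 < ε) (h : Q.Admissible ε) :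
    StrictConvex ℝ (Q.f '' closedBall 0 ε) ∧
      ∀ x, ‖x‖ ≤ ε → Q.f x ∉ interior (Q.f '' closedBall 0 ε) → ‖x‖ = ε := by
  refine strictConvex_image_closedBall Q.contDiff.continuous f_zero hε fun t ht htε c hc => ?_
  simp_rw [Q.inner_f]
  exact exists_unique_minimizer (Q.symm c) ht fun x hx => htε.trans (h c hc x hx)

theorem StrictlyAdmissible.stronglyConvexSet {ε : ℝ} (hε : 0 < ε) (h : Q.StrictlyAdmissible ε) :
    StronglyConvexSet (Q.f '' closedBall 0 ε) := by
  obtain ⟨η, hη, hgap⟩ := h.exists_gap hε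
  obtain ⟨L, hL⟩ := (Q.contDiff.of_le (m := 1) (by simp)).contDiffOn.exists_lipschitzOnWith
    one_ne_zero (convex_closedBall (0 : E) ε) (isCompact_closedBall (0 : E) ε)
  -- Growth η|y - x|² in the source becomes α|f y - f x|² in the image because f is Lipschitz on the
  -- ball; L + 1 avoids division by zero.
  set α : ℝ := η / (L + 1) ^ 2
  have hL1 : (0 : ℝ) < L + 1 := by positivity
  have hα : 0 < α := by positivity
  have hsupp : ∀ c : V, ‖c‖ = 1 → ∃ p ∈ Q.f '' closedBall 0 ε, ∀ Y ∈ Q.f '' closedBall 0 ε,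
      ⟪c, p⟫ + α * ‖Y - p‖ ^ 2 ≤ ⟪c, Y⟫ := by
    intro c hc
    obtain ⟨r, x, hr, hx, hxε⟩ := hgap c hc
    have hxb : x ∈ closedBall (0 : E) ε := mem_closedBall_zero_iff.2 hxε.le
    refine ⟨Q.f x, ⟨x, hxb, rfl⟩, ?_⟩
    rintro _ ⟨y, hy, rfl⟩
    have h1 := inner_add_le hx hr hη.le (hxε ▸ mem_closedBall_zero_iff.1 hy)
    have h2 : ‖Q.f y - Q.f x‖ ≤ (L + 1) * ‖y - x‖ := by
      have := hL.dist_le_mul y hy x hxb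
      rw [dist_eq_norm, dist_eq_norm] at this
      nlinarith [norm_nonneg (y - x)]
    have h3 : α * ‖Q.f y - Q.f x‖ ^ 2 ≤ η * ‖y - x‖ ^ 2 := by
      calc α * ‖Q.f y - Q.f x‖ ^ 2 ≤ α * ((L + 1) * ‖y - x‖) ^ 2 := by gcongr
        _ = η * ‖y - x‖ ^ 2 := by simp only [α]; field_simp
    linarith
  refine ⟨α, hα, fun x hx y hy t ht z hz => ?_⟩
  have hclosed : IsClosed (Q.f '' closedBall (0 : E) ε) :=
    ((isCompact_closedBall _ _).image Q.contDiff.continuous).isClosed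
  refine mem_of_forall_unit_inner_le hclosed (h.admissible.strictConvex hε).1.convex
    fun c hc => ?_
  obtain ⟨p, hp, hpmin⟩ := hsupp c hc
  refine ⟨p, hp, ?_⟩
  have h1 := mul_le_mul_of_nonneg_left (hpmin x hx) ht.1
  have h2 := mul_le_mul_of_nonneg_left (hpmin y hy) (sub_nonneg.2 ht.2)
  -- Averaging the two support inequalities gains at least the variance t(1 - t)|x - y|², which pays
  -- for moving by the radius of the ball.
  have h3 : t * (1 - t) * ‖x - y‖ ^ 2 ≤ t * ‖x - p‖ ^ 2 + (1 - t) * ‖y - p‖ ^ 2 := by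
    have e : t * ‖x - p‖ ^ 2 + (1 - t) * ‖y - p‖ ^ 2 =
        t * (1 - t) * ‖x - y‖ ^ 2 + ‖t • (x - p) + (1 - t) • (y - p)‖ ^ 2 := by
      have hxy : x - y = (x - p) - (y - p) := by abel
      rw [hxy]
      generalize x - p = a
      generalize y - p = b
      simp only [← real_inner_self_eq_norm_sq, inner_add_left, inner_add_right, inner_sub_left,
        inner_sub_right, inner_smul_left, inner_smul_right, conj_trivial, real_inner_comm a b]
      ring
    rw [e]
    nlinarith [sq_nonneg ‖t • (x - p) + (1 - t) • (y - p)‖]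
  have h4 : -(α * t * (1 - t) * ‖x - y‖ ^ 2) ≤ ⟪c, z - (t • x + (1 - t) • y)⟫ := by
    have h5 := abs_real_inner_le_norm c (z - (t • x + (1 - t) • y))
    rw [hc, one_mul, ← dist_eq_norm] at h5
    have h6 := neg_abs_le ⟪c, z - (t • x + (1 - t) • y)⟫
    have h7 : dist z (t • x + (1 - t) • y) ≤ α * t * (1 - t) * ‖x - y‖ ^ 2 := hz
    linarith
  rw [inner_sub_right, inner_add_right, inner_smul_right, inner_smul_right] at h4
  have h8 := mul_le_mul_of_nonneg_left h3 hα.le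
  linarith

end QuadFamily

/-! ### Smoothness of the boundary -/

namespace QuadFamily

variable {E V : Type*} [NormedAddCommGroup E] [InnerProductSpace ℝ E]
  [NormedAddCommGroup V] [InnerProductSpace ℝ V]

/-- The map `(x, r, c, s) ↦ ((T_c + r) x - w_c, |x|², f x - s c, |c|²)`: for `s = 0` its level sets
describe the boundary points `f x` with normal `c` and multiplier `r`, and `s` is the signed
distance from the boundary. -/
noncomputable def normalMap (Q : QuadFamily E V) (z : E × ℝ × V × ℝ) : E × ℝ × V × ℝ :=
  (Q.T z.2.2.1 z.1 + z.2.1 • z.1 - Q.w z.2.2.1, ⟪z.1, z.1⟫, Q.f z.1 - z.2.2.2 • z.2.2.1,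
    ⟪z.2.2.1, z.2.2.1⟫)

variable {Q : QuadFamily E V}

theorem contDiff_normalMap : ContDiff ℝ ω Q.normalMap := by
  have hf := Q.contDiff
  unfold normalMap
  refine ContDiff.prodMk ?_ (ContDiff.prodMk ?_ (ContDiff.prodMk ?_ ?_))
  · exact (((Q.T.contDiff.comp (by fun_prop)).clm_apply contDiff_fst).add (by fun_prop)).sub
      (Q.w.contDiff.comp (by fun_prop))
  · exact contDiff_fst.inner ℝ contDiff_fst
  · exact (hf.comp contDiff_fst).sub (by fun_prop)
  · exact ContDiff.inner ℝ (by fun_prop) (by fun_prop)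

theorem fderiv_normalMap (x : E) (r : ℝ) (c : V) (s : ℝ) (h : E × ℝ × V × ℝ) :
    fderiv ℝ Q.normalMap (x, r, c, s) h
      = (Q.T c h.1 + Q.T h.2.2.1 x + (r • h.1 + h.2.1 • x) - Q.w h.2.2.1, 2 * ⟪x, h.1⟫,
        fderiv ℝ Q.f x h.1 - (s • h.2.2.1 + h.2.2.2 • c), 2 * ⟪c, h.2.2.1⟫) := by
  set z : E × ℝ × V × ℝ := (x, r, c, s)
  let px : E × ℝ × V × ℝ →L[ℝ] E := ContinuousLinearMap.fst ℝ _ _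
  let pr : E × ℝ × V × ℝ →L[ℝ] ℝ :=
    (ContinuousLinearMap.fst ℝ _ _).comp (ContinuousLinearMap.snd ℝ _ _)
  let pc : E × ℝ × V × ℝ →L[ℝ] V := (ContinuousLinearMap.fst ℝ _ _).comp
    ((ContinuousLinearMap.snd ℝ _ _).comp (ContinuousLinearMap.snd ℝ _ _))
  let ps : E × ℝ × V × ℝ →L[ℝ] ℝ := (ContinuousLinearMap.snd ℝ _ _).comp
    ((ContinuousLinearMap.snd ℝ _ _).comp (ContinuousLinearMap.snd ℝ _ _))
  have hx : HasFDerivAt (fun z : E × ℝ × V × ℝ => z.1) px z := px.hasFDerivAt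
  have hr : HasFDerivAt (fun z : E × ℝ × V × ℝ => z.2.1) pr z := pr.hasFDerivAt
  have hc : HasFDerivAt (fun z : E × ℝ × V × ℝ => z.2.2.1) pc z := pc.hasFDerivAt
  have hs : HasFDerivAt (fun z : E × ℝ × V × ℝ => z.2.2.2) ps z := ps.hasFDerivAt
  have hf : HasFDerivAt Q.f (fderiv ℝ Q.f x) z.1 :=
    (Q.contDiff.differentiable (by simp) x).hasFDerivAt
  have h1 := ((((Q.T.hasFDerivAt (x := z.2.2.1)).comp z hc).clm_apply hx).add (hr.smul hx)).sub
    ((Q.w.hasFDerivAt (x := z.2.2.1)).comp z hc)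
  have h2 := hx.inner ℝ hx
  have h3 := (hf.comp z hx).sub (hs.smul hc)
  have h4 := hc.inner ℝ hc
  have key := (h1.prodMk (h2.prodMk (h3.prodMk h4))).fderiv
  have e : Q.normalMap = fun z => (Q.T z.2.2.1 z.1 + z.2.1 • z.1 - Q.w z.2.2.1, ⟪z.1, z.1⟫,
    Q.f z.1 - z.2.2.2 • z.2.2.1, ⟪z.2.2.1, z.2.2.1⟫) := rfl
  rw [e]
  refine (congrArg (fun L : E × ℝ × V × ℝ →L[ℝ] E × ℝ × V × ℝ => L h) key).trans ?_
  refine Prod.ext ?_ (Prod.ext ?_ (Prod.ext ?_ ?_))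
  · simp [z, px, pr, pc]
  · simp [z, px, real_inner_comm]
    ring
  · simp [z, px, ps, pc]
  · simp [z, pc, real_inner_comm]
    ring

/-- A point outside the image lies on the outward normal of its nearest point. -/
theorem exists_normal_of_notMem {F : Set V} (hF : IsCompact F) (hF' : Convex ℝ F)
    (hne : F.Nonempty) {Y : V} (hY : Y ∉ F) :
    ∃ q ∈ F, ∃ c : V, ∃ s : ℝ, ‖c‖ = 1 ∧ 0 < s ∧ Y = q - s • c ∧ (∀ z ∈ F, ‖Y - q‖ ≤ ‖Y - z‖) ∧
      s = ‖Y - q‖ ∧ ∀ z ∈ F, ⟪c, q⟫ ≤ ⟪c, z⟫ := by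
  obtain ⟨q, hq, hqmin⟩ := exists_norm_eq_iInf_of_complete_convex hne hF.isComplete hF' Y
  have hproj := (norm_eq_iInf_iff_real_inner_le_zero hF' hq).1 hqmin
  have hpos : 0 < ‖Y - q‖ := by
    refine norm_pos_iff.2 (sub_ne_zero.2 ?_)
    rintro rfl
    exact hY hq
  refine ⟨q, hq, ‖Y - q‖⁻¹ • (q - Y), ‖Y - q‖, ?_, hpos, ?_, fun z hz => ?_, rfl, fun z hz => ?_⟩
  · rw [norm_smul, norm_inv, norm_norm, norm_sub_rev q Y, inv_mul_cancel₀ hpos.ne']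
  · rw [smul_smul, mul_inv_cancel₀ hpos.ne', one_smul]
    abel
  · rw [hqmin]
    exact ciInf_le ⟨0, by rintro _ ⟨_, rfl⟩; exact norm_nonneg _⟩ (⟨z, hz⟩ : F)
  · have h1 := hproj z hz
    rw [inner_smul_left, inner_smul_left, conj_trivial]
    refine mul_le_mul_of_nonneg_left ?_ (inv_nonneg.2 hpos.le)
    have h2 : ⟪q - Y, z - q⟫ = -⟪Y - q, z - q⟫ := by rw [← inner_neg_left, neg_sub]
    rw [inner_sub_right] at h2
    linarith

variable [FiniteDimensional ℝ E]

/-- For (u, q, d, s) in the kernel, pairing the third component with d ⟂ c and the first with u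
leaves ⟪(T_c + r)u, u⟫ = 0, so u = 0. Then s = 0, and x satisfies the equation of d with multiplier
-q up to sign convention, so uniqueness of normals makes d a multiple of c; being orthogonal to c it
vanishes, and so does q. -/
theorem StrictlyAdmissible.ker_fderiv_normalMap [Nontrivial E] {ε : ℝ}
    (h : Q.StrictlyAdmissible ε) {c : V} {r : ℝ} {x : E} (hc1 : c ≠ 0) (hx0 : x ≠ 0)
    (hxε : ‖x‖ ≤ ε) (hr : shift (Q.T c) < r) (hc : Q.T c x + r • x = Q.w c)
    {k : E × ℝ × V × ℝ} (hk : fderiv ℝ Q.normalMap (x, r, c, 0) k = 0) : k = 0 := by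
  obtain ⟨u, q, d, s⟩ := k
  rw [fderiv_normalMap] at hk
  simp only [Prod.mk_eq_zero, zero_smul, zero_add, mul_eq_zero, OfNat.ofNat_ne_zero,
    false_or] at hk
  obtain ⟨h1, h2, h3, h4⟩ := hk
  have h5 : ⟪Q.T d x - Q.w d, u⟫ = 0 := by
    have h6 : ⟪d, fderiv ℝ Q.f x u⟫ = 0 := by
      rw [sub_eq_zero.1 h3, inner_smul_right, real_inner_comm, h4, mul_zero]
    rw [inner_fderiv] at h6
    linarith
  have h6 : ⟪Q.T c u, u⟫ + r * ‖u‖ ^ 2 = 0 := by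
    have h7 := congrArg (fun v => ⟪v, u⟫) h1
    simp only [inner_sub_left, inner_add_left, inner_smul_left, conj_trivial, inner_zero_left,
      real_inner_self_eq_norm_sq, h2] at h7 h5
    linarith
  have h7 := add_shift_nonneg (Q.T c) u
  have hu : u = 0 := by
    have : ‖u‖ ^ 2 = 0 := by nlinarith [sq_nonneg ‖u‖]
    simpa using this
  subst hu
  have hs : s = 0 := by
    rw [map_zero, zero_sub, neg_eq_zero, smul_eq_zero] at h3
    exact h3.resolve_right hc1
  have hd : d = (q / r) • c := by
    refine h.eq_smul_of_normal hxε hr hc (s := q) ?_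
    rw [map_zero, smul_zero, zero_add, zero_add, sub_eq_zero] at h1
    exact h1
  have hd0 : d = 0 := by
    rw [hd, inner_smul_right, mul_eq_zero] at h4
    rcases h4 with h4 | h4
    · rw [hd, h4, zero_smul]
    · exact absurd (inner_self_eq_zero.1 h4) hc1
  have hq : q = 0 := by
    subst hd0
    simp only [map_zero, zero_apply, smul_zero, zero_add, sub_zero, smul_eq_zero] at h1
    exact h1.resolve_right hx0
  rw [hd0, hq, hs]
  rfl

/-- The defining function is the s-component of the local inverse of `normalMap` at (0, ε², Y, 1),
that is, the signed distance of Y from the boundary, positive outside. -/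
theorem StrictlyAdmissible.hasSmoothBoundary [FiniteDimensional ℝ V] [Nontrivial V]
    [Nontrivial E] {ε : ℝ} (hε : 0 < ε) (h : Q.StrictlyAdmissible ε) :
    HasSmoothBoundary (Q.f '' closedBall 0 ε) := by
  intro p hp
  set F := Q.f '' closedBall (0 : E) ε with hFdef
  have hFc : IsCompact F := (isCompact_closedBall _ _).image Q.contDiff.continuous
  have hFconv : Convex ℝ F := (h.admissible.strictConvex hε).1.convex
  have hFne : F.Nonempty := ⟨_, 0, by simp [hε.le], rfl⟩
  have hball : ∀ {x : E}, ‖x‖ = ε → Q.f x ∈ F :=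
    fun hx => ⟨_, mem_closedBall_zero_iff.2 hx.le, rfl⟩
  rw [hFc.isClosed.frontier_eq] at hp
  obtain ⟨hpF, hpint⟩ := hp
  obtain ⟨η, hη, hgap⟩ := h.exists_gap hε
  obtain ⟨c₀, hc₀, hpmin⟩ : ∃ c : V, ‖c‖ = 1 ∧ ∀ z ∈ F, ⟪c, p⟫ ≤ ⟪c, z⟫ := by
    by_contra! hcon
    exact hpint (mem_interior_of_forall_unit_inner_lt hFc.isClosed hFconv hcon)
  obtain ⟨r₀, x₀, hr₀, hx₀, hx₀ε⟩ := hgap c₀ hc₀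
  have hr₀' : shift (Q.T c₀) < r₀ := by linarith
  have hr₀pos : 0 < r₀ := (shift_nonneg _).trans_lt hr₀'
  have hp0 : Q.f x₀ = p := by
    obtain ⟨y, hy, rfl⟩ := hpF
    rw [eq_of_inner_le hx₀ hr₀ hη (hx₀ε ▸ mem_closedBall_zero_iff.1 hy) (hpmin _ (hball hx₀ε))]
  have hc₀ne : c₀ ≠ 0 := by rintro rfl; simp at hc₀
  have hx₀ne : x₀ ≠ 0 := by rintro rfl; simp at hx₀ε; exact hε.ne hx₀ε
  set z₀ : E × ℝ × V × ℝ := (x₀, r₀, c₀, 0) with hz₀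
  have hinj : Function.Injective (fderiv ℝ Q.normalMap z₀ : E × ℝ × V × ℝ →ₗ[ℝ] E × ℝ × V × ℝ) :=
    (injective_iff_map_eq_zero _).2 fun k hk =>
      h.ker_fderiv_normalMap hc₀ne hx₀ne hx₀ε.le hr₀' hx₀ hk
  let D : (E × ℝ × V × ℝ) ≃L[ℝ] (E × ℝ × V × ℝ) :=
    (LinearEquiv.ofInjectiveEndo _ hinj).toContinuousLinearEquiv
  have hD : HasFDerivAt Q.normalMap (D : E × ℝ × V × ℝ →L[ℝ] E × ℝ × V × ℝ) z₀ := by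
    have : (D : E × ℝ × V × ℝ →L[ℝ] E × ℝ × V × ℝ) = fderiv ℝ Q.normalMap z₀ := by
      ext k <;> rfl
    rw [this]
    exact (contDiff_normalMap.differentiable (by simp) z₀).hasFDerivAt
  have hcd : ContDiffAt ℝ ω Q.normalMap z₀ := contDiff_normalMap.contDiffAt
  have hω : (ω : WithTop ℕ∞) ≠ 0 := by simp
  set Ψ := hcd.toOpenPartialHomeomorph Q.normalMap hD hω with hΨ
  have hΨcoe : ∀ z, Ψ z = Q.normalMap z := fun z => rfl
  have hz₀s : z₀ ∈ Ψ.source := hcd.mem_toOpenPartialHomeomorph_source hD hω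
  set J : V → E × ℝ × V × ℝ := fun Y => (0, ε ^ 2, Y, 1) with hJ
  have hJcont : Continuous J := by fun_prop
  have hJcd : ContDiff ℝ ∞ J := by fun_prop
  have hmap : ∀ {x : E} {r : ℝ} {c : V} {s : ℝ}, Q.T c x + r • x = Q.w c → ‖x‖ = ε → ‖c‖ = 1 →
      Q.normalMap (x, r, c, s) = J (Q.f x - s • c) := by
    intro x r c s h1 h2 h3
    simp [normalMap, J, h1, h2, h3]
  have hJp : J p = Ψ z₀ := by
    rw [hΨcoe, hz₀, hmap hx₀ hx₀ε hc₀, hp0, zero_smul, sub_zero]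
  have hsymm0 : Ψ.symm (J p) = z₀ := by rw [hJp, Ψ.left_inv hz₀s]
  have hJpt : J p ∈ Ψ.target := hJp ▸ Ψ.map_source hz₀s
  have hsymmcont : ContinuousAt (fun Y => Ψ.symm (J Y)) p :=
    (Ψ.continuousAt_symm hJpt).comp hJcont.continuousAt
  have ev1 : ∀ᶠ Y in 𝓝 p, J Y ∈ Ψ.target :=
    hJcont.continuousAt.eventually_mem (Ψ.open_target.mem_nhds hJpt)
  have ev2 : ∀ᶠ Y in 𝓝 p, ContDiffAt ℝ ω Ψ.symm (J Y) := by
    have h1 : ContDiffAt ℝ ω Ψ.symm (J p) := by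
      rw [hJp]
      exact hcd.to_localInverse hD hω
    exact hJcont.continuousAt.eventually (h1.eventually (by simp))
  have ev3 : ∀ᶠ Y in 𝓝 p, shift (Q.T (Ψ.symm (J Y)).2.2.1) < (Ψ.symm (J Y)).2.1 := by
    have hopen : IsOpen {z : E × ℝ × V × ℝ | shift (Q.T z.2.2.1) < z.2.1} :=
      isOpen_lt (continuous_shift.comp (Q.T.continuous.comp (by fun_prop))) (by fun_prop)
    refine hsymmcont.eventually_mem (hopen.mem_nhds ?_)
    rw [hsymm0]
    exact hr₀'
  -- The multiplier is a continuous function of x and c on the sphere |x| = ε, so only (x, c, s),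
  -- which ranges over a compact set, has to be controlled.
  let m : E × V → ℝ := fun k => ⟪Q.w k.2 - Q.T k.2 k.1, k.1⟫ / ε ^ 2
  have hmc : Continuous m := by
    refine Continuous.div_const (Continuous.inner ((Q.w.continuous.comp continuous_snd).sub
      ((Q.T.continuous.comp continuous_snd).clm_apply continuous_fst)) continuous_fst) _
  have hmeq : ∀ {x : E} {c : V} {r : ℝ}, ‖x‖ = ε → Q.T c x + r • x = Q.w c → m (x, c) = r := by
    intro x c r hx hr
    simp only [m]
    rw [← hr, add_sub_cancel_left, inner_smul_left, real_inner_self_eq_norm_sq, hx, conj_trivial]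
    field_simp
  -- A local inverse sees only data near z₀, so the nearest-point data of an outside Y must be shown
  -- to lie in its source. At Y = p the only admissible data are z₀ itself; compactness extends this
  -- to nearby Y.
  have ev4 : ∀ᶠ Y in 𝓝 p, ∀ k ∈ sphere (0 : E) ε ×ˢ sphere (0 : V) 1 ×ˢ Set.Icc (0 : ℝ) 1,
      Y = Q.f k.1 - k.2.2 • k.2.1 → shift (Q.T k.2.1) + η ≤ m (k.1, k.2.1) →
      Q.T k.2.1 k.1 + m (k.1, k.2.1) • k.1 = Q.w k.2.1 →
      (k.1, m (k.1, k.2.1), k.2.1, k.2.2) ∈ Ψ.source := by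
    refine ((isCompact_sphere _ _).prod ((isCompact_sphere _ _).prod
      isCompact_Icc)).eventually_forall_of_forall_eventually ?_
    rintro ⟨x, c, s⟩ ⟨hx, hc, hs⟩
    simp only [mem_sphere_zero_iff_norm] at hx hc
    have hfc := Q.contDiff.continuous
    have hm1 : Continuous fun b : V × E × V × ℝ => m (b.2.1, b.2.2.1) := hmc.comp (by fun_prop)
    have hclosed : IsClosed {b : V × E × V × ℝ | b.1 = Q.f b.2.1 - b.2.2.2 • b.2.2.1 ∧
        shift (Q.T b.2.2.1) + η ≤ m (b.2.1, b.2.2.1) ∧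
        Q.T b.2.2.1 b.2.1 + m (b.2.1, b.2.2.1) • b.2.1 = Q.w b.2.2.1} := by
      refine (isClosed_eq (by fun_prop) (by fun_prop)).and ((isClosed_le ?_ hm1).and
        (isClosed_eq ?_ ?_))
      · exact (continuous_shift.comp (Q.T.continuous.comp (by fun_prop))).add continuous_const
      · exact ((Q.T.continuous.comp (by fun_prop)).clm_apply (by fun_prop)).add
          (hm1.smul (by fun_prop))
      · exact Q.w.continuous.comp (by fun_prop)
    by_cases hrel : (p, x, c, s) ∈ {b : V × E × V × ℝ | b.1 = Q.f b.2.1 - b.2.2.2 • b.2.2.1 ∧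
        shift (Q.T b.2.2.1) + η ≤ m (b.2.1, b.2.2.1) ∧
        Q.T b.2.2.1 b.2.1 + m (b.2.1, b.2.2.1) • b.2.1 = Q.w b.2.2.1}
    · obtain ⟨g1, g2, g3⟩ := hrel
      simp only at g1 g2 g3
      have hsc : ⟪c, s • c⟫ = s := by
        rw [inner_smul_right, real_inner_self_eq_norm_sq, hc]; ring
      -- For s > 0 the point f x - s c lies strictly beyond the supporting hyperplane at f x,
      -- whereas p is in the image.
      have hs0 : s = 0 := by
        obtain ⟨y, hy, hyp⟩ := hpF
        have g4 := inner_le g3 g2 hη.le (hx.symm ▸ mem_closedBall_zero_iff.1 hy)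
        rw [hyp, g1, inner_sub_right, hsc] at g4
        exact le_antisymm (by linarith) hs.1
      subst hs0
      rw [zero_smul, sub_zero] at g1
      have hxx : x = x₀ := eq_of_inner_le hx₀ hr₀ hη (hx₀ε ▸ hx.le) (by rw [← g1, hp0])
      subst hxx
      have hcc := h.eq_smul_of_normal hx₀ε.le hr₀' hx₀ g3
      have hmpos : 0 < m (x, c) := by linarith [shift_nonneg (Q.T c)]
      have hratio : m (x, c) / r₀ = 1 := by
        have := congrArg norm hcc
        rw [norm_smul, hc, hc₀, mul_one, Real.norm_of_nonneg (by positivity)] at this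
        exact this.symm
      rw [hratio, one_smul] at hcc
      subst hcc
      have hcontk : ContinuousAt (fun b : V × E × V × ℝ =>
          (b.2.1, m (b.2.1, b.2.2.1), b.2.2.1, b.2.2.2)) (p, x, c, 0) := by
        refine Continuous.continuousAt ?_
        fun_prop
      have hval : (x, m (x, c), c, (0 : ℝ)) = z₀ := by rw [hmeq hx₀ε hx₀]
      have := hcontk.eventually_mem (Ψ.open_source.mem_nhds (by rw [hval]; exact hz₀s))
      filter_upwards [this] with b hb _ _ _ using hb
    · filter_upwards [hclosed.isOpen_compl.mem_nhds hrel] with b hb g1 g2 g3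
      exact absurd ⟨g1, g2, g3⟩ hb
  have ev5 : ∀ᶠ Y in 𝓝 p, ‖Y - p‖ < 1 := by
    filter_upwards [Metric.ball_mem_nhds p one_pos] with Y hY
    rwa [mem_ball, dist_eq_norm] at hY
  obtain ⟨U, hU, hUo, hpU⟩ := _root_.eventually_nhds_iff.1
    (ev1.and (ev2.and (ev3.and (ev4.and ev5))))
  refine ⟨U, hUo, hpU, fun Y => (Ψ.symm (J Y)).2.2.2, ?_, ?_, ?_⟩
  · intro Y hY
    have h1 : ContDiffAt ℝ ∞ Ψ.symm (J Y) := (hU Y hY).2.1.of_le le_top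
    have h2 : ContDiffAt ℝ ∞ (fun Y => Ψ.symm (J Y)) Y := h1.comp Y hJcd.contDiffAt
    exact (h2.snd.snd.snd).contDiffWithinAt
  · intro Y hY h0
    obtain ⟨g1, g2, -⟩ := hU Y hY
    have h2 : DifferentiableAt ℝ (fun Y => (Ψ.symm (J Y)).2.2.2) Y := by
      have h1 : DifferentiableAt ℝ Ψ.symm (J Y) := g2.differentiableAt hω
      have h3 : DifferentiableAt ℝ (fun Y => Ψ.symm (J Y)) Y :=
        h1.comp Y (hJcd.differentiable (by simp) Y)
      exact h3.snd.snd.snd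
    have hright : Q.normalMap (Ψ.symm (J Y)) = J Y := Ψ.right_inv g1
    have hsrc := Ψ.map_target g1
    set z := Ψ.symm (J Y) with hz
    -- Moving Y by -τc raises s by exactly τ, so the derivative in direction -c is 1 and cannot
    -- vanish.
    let γ : ℝ → E × ℝ × V × ℝ := fun τ => (z.1, z.2.1, z.2.2.1, z.2.2.2 + τ)
    have hγ : Continuous γ := by fun_prop
    have hγ0 : γ 0 = z := by simp [γ]
    have hev : ∀ᶠ τ in 𝓝 (0 : ℝ), γ τ ∈ Ψ.source :=
      hγ.continuousAt.eventually_mem (Ψ.open_source.mem_nhds (by rw [hγ0]; exact hsrc))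
    have hγJ : ∀ τ, Q.normalMap (γ τ) = J (Y - τ • z.2.2.1) := by
      intro τ
      have e := hright
      simp only [normalMap, J, Prod.mk.injEq] at e
      obtain ⟨e1, e2, e3, e4⟩ := e
      simp only [normalMap, J, γ, e1, e2, e4, ← e3, add_smul, sub_sub]
    have hline : HasDerivAt (fun τ : ℝ => (Ψ.symm (J (Y - τ • z.2.2.1))).2.2.2) 0 0 := by
      have h5 : HasDerivAt (fun τ : ℝ => Y - τ • z.2.2.1) (-z.2.2.1) 0 := by
        simpa using ((hasDerivAt_id (0 : ℝ)).smul_const z.2.2.1).const_sub Y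
      have h6 := h2.hasFDerivAt
      rw [h0] at h6
      have h7 : HasFDerivAt (fun Y => (Ψ.symm (J Y)).2.2.2) (0 : V →L[ℝ] ℝ)
          (Y - (0 : ℝ) • z.2.2.1) := by simpa using h6
      have h8 := h7.comp_hasDerivAt (0 : ℝ) h5
      rw [zero_apply] at h8
      exact h8
    have hline' : HasDerivAt (fun τ : ℝ => (Ψ.symm (J (Y - τ • z.2.2.1))).2.2.2) 1 0 := by
      have h5 : HasDerivAt (fun τ : ℝ => z.2.2.2 + τ) 1 0 := (hasDerivAt_id (0 : ℝ)).const_add _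
      refine h5.congr_of_eventuallyEq ?_
      filter_upwards [hev] with τ hτ
      rw [← hγJ, ← hΨcoe, Ψ.left_inv hτ]
    exact zero_ne_one (hline.unique hline')
  · ext Y
    constructor
    · rintro ⟨hYF, hY⟩
      refine ⟨hY, ?_⟩
      obtain ⟨g1, -, g3, -⟩ := hU Y hY
      have hright : Q.normalMap (Ψ.symm (J Y)) = J Y := Ψ.right_inv g1
      show (Ψ.symm (J Y)).2.2.2 ≤ 0
      generalize Ψ.symm (J Y) = z at hright g3 ⊢
      obtain ⟨x, r, c, s⟩ := z
      simp only [normalMap, J, Prod.mk.injEq, real_inner_self_eq_norm_sq] at hright g3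
      obtain ⟨e1, e2, e3, e4⟩ := hright
      obtain ⟨y, hy, rfl⟩ := hYF
      have hxε : ‖x‖ = ε := (sq_eq_sq₀ (norm_nonneg _) hε.le).1 e2
      -- The inverse yields a supporting functional c at f x, and Y = f x - s c lies on its inner
      -- side, hence s ≤ 0.
      have h1 := inner_le (sub_eq_zero.1 e1) (η := 0) (by linarith) le_rfl
        (hxε.symm ▸ mem_closedBall_zero_iff.1 hy)
      rw [← e3, inner_sub_right, inner_smul_right, real_inner_self_eq_norm_sq, e4] at h1
      show s ≤ 0
      linarith
    · rintro ⟨hY, hYs⟩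
      refine ⟨?_, hY⟩
      by_contra hYF
      obtain ⟨-, -, -, g4, g5⟩ := hU Y hY
      obtain ⟨q, hqF, c, s, hc, hs, hYq, hmin, hsn, hsupp⟩ :=
        exists_normal_of_notMem hFc hFconv hFne hYF
      obtain ⟨r, x, hr, hx, hxε⟩ := hgap c hc
      have hqx : Q.f x = q := by
        obtain ⟨y, hy, rfl⟩ := hqF
        rw [eq_of_inner_le hx hr hη (hxε ▸ mem_closedBall_zero_iff.1 hy) (hsupp _ (hball hxε))]
      have hs1 : s ≤ 1 := by
        rw [hsn]
        exact (hmin p hpF).trans g5.le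
      have hm := hmeq hxε hx
      have hsrc := g4 (x, c, s) ⟨mem_sphere_zero_iff_norm.2 hxε, mem_sphere_zero_iff_norm.2 hc,
        hs.le, hs1⟩ (by simp only [hqx]; exact hYq) (by simp only [hm]; exact hr)
        (by simp only [hm]; exact hx)
      simp only [hm] at hsrc
      have hΨY : Ψ (x, r, c, s) = J Y := by
        rw [hΨcoe, hmap hx hxε hc, hqx, ← hYq]
      have : Ψ.symm (J Y) = (x, r, c, s) := by rw [← hΨY, Ψ.left_inv hsrc]
      simp only [this] at hYs
      linarith

end QuadFamily

/-! ### From matrices over 𝕜 to real operators, and the meaning of `epsMaxSq` -/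

variable {𝕜 : Type*} [RCLike 𝕜] {m n : ℕ}

theorem real_inner_eq_re (x y : EuclideanSpace 𝕜 (Fin n)) :
    ⟪x, y⟫ = RCLike.re (inner 𝕜 x y) := by
  simp only [PiLp.inner_apply, map_sum]
  rfl

/-- The operator of a matrix, as a continuous real-linear map. -/
noncomputable def opCLM : Matrix (Fin n) (Fin n) 𝕜 →ₗ[ℝ]
    EuclideanSpace 𝕜 (Fin n) →L[ℝ] EuclideanSpace 𝕜 (Fin n) where
  toFun M := LinearMap.toContinuousLinearMap ((Matrix.toEuclideanLin M).restrictScalars ℝ)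
  map_add' M N := by ext x i; simp
  map_smul' r M := by
    ext x i
    simp [Matrix.toLpLin_apply, Matrix.smul_mulVec]

theorem opCLM_apply (M : Matrix (Fin n) (Fin n) 𝕜) (x : EuclideanSpace 𝕜 (Fin n)) :
    opCLM M x = Matrix.toEuclideanLin M x := rfl

theorem opCLM_one (x : EuclideanSpace 𝕜 (Fin n)) :
    opCLM (1 : Matrix (Fin n) (Fin n) 𝕜) x = x := by
  simp [opCLM_apply]

theorem opCLM_mul (M N : Matrix (Fin n) (Fin n) 𝕜) (x : EuclideanSpace 𝕜 (Fin n)) :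
    opCLM (M * N) x = opCLM M (opCLM N x) := by
  simp [opCLM_apply, Matrix.toLpLin_apply]

theorem opCLM_symm {M : Matrix (Fin n) (Fin n) 𝕜} (hM : M.IsHermitian)
    (x y : EuclideanSpace 𝕜 (Fin n)) : ⟪opCLM M x, y⟫ = ⟪x, opCLM M y⟫ := by
  rw [real_inner_eq_re, real_inner_eq_re]
  exact congrArg _ (Matrix.isSymmetric_toEuclideanLin_iff.2 hM x y)

theorem continuous_opCLM : Continuous (opCLM : Matrix (Fin n) (Fin n) 𝕜 →ₗ[ℝ] _) :=
  LinearMap.continuous_of_finiteDimensional _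

theorem isUnit_det_iff (M : Matrix (Fin n) (Fin n) 𝕜) :
    IsUnit M.det ↔ ∀ x, opCLM M x = 0 → x = 0 := by
  rw [isUnit_iff_ne_zero, ne_eq, ← Matrix.exists_mulVec_eq_zero_iff]
  push Not
  constructor
  · intro h x hx
    by_contra hx0
    refine h x.ofLp (fun h0 => hx0 (by ext i; simpa using congrFun h0 i)) ?_
    simpa [opCLM_apply, Matrix.toLpLin_apply] using hx
  · intro h x hx0 hx
    refine hx0 ?_
    have := h (WithLp.toLp 2 x) (by simp [opCLM_apply, Matrix.toLpLin_apply, hx])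
    simpa using this

theorem mem_spectrum_iff (M : Matrix (Fin n) (Fin n) 𝕜) (r : ℝ) :
    r ∈ spectrum ℝ M ↔ ∃ x, x ≠ 0 ∧ opCLM M x = r • x := by
  rw [spectrum.mem_iff, Matrix.isUnit_iff_isUnit_det, isUnit_det_iff]
  push Not
  refine exists_congr fun x => ?_
  rw [and_comm, Algebra.algebraMap_eq_smul_one, map_sub, map_smul, sub_apply, smul_apply,
    opCLM_one, sub_eq_zero, eq_comm (a := r • x)]

/-- The minimum of the quadratic form on the unit sphere is attained at an eigenvector and bounds
all eigenvalues from below, so it is the infimum of the spectrum. -/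
theorem lamMin_spec [NeZero n] {M : Matrix (Fin n) (Fin n) 𝕜} (hM : M.IsHermitian) :
    (∀ x, lamMin M * ‖x‖ ^ 2 ≤ ⟪opCLM M x, x⟫) ∧ ∃ u, u ≠ 0 ∧ opCLM M u = lamMin M • u := by
  set S := (fun u => ⟪opCLM M u, u⟫) '' sphere (0 : EuclideanSpace 𝕜 (Fin n)) 1
  have hS : IsCompact S := (isCompact_sphere _ _).image (continuous_inner_map_self _)
  obtain ⟨u, hu, hu'⟩ := hS.sInf_mem ((NormedSpace.sphere_nonempty.2 zero_le_one).image _)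
  set ρ := sInf S
  have hpsd : ∀ x, 0 ≤ ⟪opCLM M x, x⟫ + (-ρ) * ‖x‖ ^ 2 := by
    intro x
    rcases eq_or_ne x 0 with rfl | hx
    · simp
    have hx' : 0 < ‖x‖ := norm_pos_iff.2 hx
    have h1 : ρ ≤ ⟪opCLM M (‖x‖⁻¹ • x), ‖x‖⁻¹ • x⟫ :=
      csInf_le hS.bddBelow ⟨‖x‖⁻¹ • x, by simp [norm_smul, hx'.ne'], rfl⟩
    rw [inner_map_smul_self, inv_pow, inv_mul_eq_div, le_div_iff₀ (by positivity)] at h1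
    linarith
  rw [mem_sphere_zero_iff_norm] at hu
  have hu0 : u ≠ 0 := by rintro rfl; simp at hu
  have heig : opCLM M u = ρ • u := by
    have := map_eq_zero_of_inner_eq_zero (opCLM_symm hM) hpsd (u := u)
      (by simp only at hu'; rw [hu', hu]; ring)
    rw [neg_smul, ← sub_eq_add_neg, sub_eq_zero] at this
    exact this
  have hlow : ∀ r ∈ spectrum ℝ M, ρ ≤ r := by
    intro r hr
    obtain ⟨x, hx, hxr⟩ := (mem_spectrum_iff M r).1 hr
    have h1 := hpsd x
    rw [hxr, inner_smul_left, real_inner_self_eq_norm_sq, conj_trivial] at h1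
    have h2 : 0 < ‖x‖ ^ 2 := by positivity
    by_contra! h3
    nlinarith
  have hmin : lamMin M = ρ :=
    le_antisymm (csInf_le ⟨ρ, hlow⟩ ((mem_spectrum_iff M ρ).2 ⟨u, hu0, heig⟩))
      (le_csInf ⟨ρ, (mem_spectrum_iff M ρ).2 ⟨u, hu0, heig⟩⟩ hlow)
  rw [hmin]
  exact ⟨fun x => by linarith [hpsd x], u, hu0, heig⟩

theorem shift_opCLM [NeZero n] {M : Matrix (Fin n) (Fin n) 𝕜} (hM : M.IsHermitian) :
    shift (opCLM M) = -lamM M := by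
  obtain ⟨h1, u, hu0, hu⟩ := lamMin_spec hM
  refine shift_eq_of (neg_nonneg.2 (min_le_right _ _)) (fun x => ?_) ?_
  · have := mul_le_mul_of_nonneg_right (min_le_left (lamMin M) 0) (sq_nonneg ‖x‖)
    unfold lamM
    linarith [h1 x]
  · unfold lamM
    rcases le_total (lamMin M) 0 with h | h
    · right
      refine ⟨u, hu0, ?_⟩
      rw [min_eq_left h, hu, inner_smul_left, real_inner_self_eq_norm_sq, conj_trivial]
      ring
    · left
      simp [h]

theorem opCLM_dotA (A : Fin m → Matrix (Fin n) (Fin n) 𝕜) (c : EuclideanSpace ℝ (Fin m)) :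
    opCLM (dotA A c) = ∑ i, c i • opCLM (A i) := by
  simp [dotA, map_sum]

theorem isHermitian_dotA {A : Fin m → Matrix (Fin n) (Fin n) 𝕜} (hA : ∀ i, (A i).IsHermitian)
    (c : EuclideanSpace ℝ (Fin m)) : (dotA A c).IsHermitian := by
  unfold dotA
  rw [Matrix.IsHermitian, Matrix.conjTranspose_sum]
  refine Finset.sum_congr rfl fun i _ => ?_
  rw [Matrix.conjTranspose_smul, (hA i).eq]
  simp

theorem quadMap_apply (A : Fin m → Matrix (Fin n) (Fin n) 𝕜) (v : Fin m → EuclideanSpace 𝕜 (Fin n))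
    (x : EuclideanSpace 𝕜 (Fin n)) (i : Fin m) :
    quadMap A v x i = ⟪opCLM (A i) x, x⟫ - 2 * ⟪v i, x⟫ := by
  simp only [quadMap, map_sub, ← real_inner_eq_re]
  rw [real_inner_comm, opCLM_apply, real_inner_comm (v i) x]
  ring

/-- The quadratic map of the theorem as an abstract family. -/
noncomputable def family (A : Fin m → Matrix (Fin n) (Fin n) 𝕜)
    (v : Fin m → EuclideanSpace 𝕜 (Fin n)) (hA : ∀ i, (A i).IsHermitian) :
    QuadFamily (EuclideanSpace 𝕜 (Fin n)) (EuclideanSpace ℝ (Fin m)) where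
  T := LinearMap.toContinuousLinearMap
    { toFun := fun c => opCLM (dotA A c)
      map_add' := fun c d => by
        rw [← map_add]
        congr 1
        simp [dotA, add_smul, Finset.sum_add_distrib]
      map_smul' := fun r c => by simp [opCLM_dotA, mul_smul, Finset.smul_sum] }
  w := LinearMap.toContinuousLinearMap
    { toFun := fun c => dotV v c
      map_add' := fun c d => by simp [dotV, add_smul, Finset.sum_add_distrib]
      map_smul' := fun r c => by simp [dotV, mul_smul, Finset.smul_sum] }
  f := quadMap A v
  symm c x y := opCLM_symm (isHermitian_dotA hA c) x y
  inner_f c x := by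
    simp only [LinearMap.coe_toContinuousLinearMap', LinearMap.coe_mk, AddHom.coe_mk, opCLM_dotA,
      dotV, sum_apply, smul_apply, sum_inner, inner_smul_left, conj_trivial, Finset.mul_sum,
      ← Finset.sum_sub_distrib]
    rw [PiLp.inner_apply]
    refine Finset.sum_congr rfl fun i _ => ?_
    rw [quadMap_apply]
    simp
    ring
  contDiff := by
    refine contDiff_euclidean.2 fun i => ?_
    simp_rw [quadMap_apply]
    exact ((opCLM (A i)).contDiff.inner ℝ contDiff_id).sub
      (contDiff_const.mul (contDiff_const.inner ℝ contDiff_id))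

section

variable {A : Fin m → Matrix (Fin n) (Fin n) 𝕜} {v : Fin m → EuclideanSpace 𝕜 (Fin n)}
  {hA : ∀ i, (A i).IsHermitian}

theorem family_T (c : EuclideanSpace ℝ (Fin m)) : (family A v hA).T c = opCLM (dotA A c) := rfl

theorem family_w (c : EuclideanSpace ℝ (Fin m)) : (family A v hA).w c = dotV v c := rfl

theorem family_f : (family A v hA).f = quadMap A v := rfl

/-- For η > 0 the matrix is positive definite, so `⁻¹` is a genuine inverse rather than its default
value 0. -/
theorem resolventSq_spec [NeZero n] (hA : ∀ i, (A i).IsHermitian)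
    (v : Fin m → EuclideanSpace 𝕜 (Fin n)) {η : ℝ} (hη : 0 < η) (c : EuclideanSpace ℝ (Fin m)) :
    ∃ x, (opCLM (dotA A c) + shift (opCLM (dotA A c)) • ContinuousLinearMap.id ℝ (EuclideanSpace 𝕜 (Fin n))) x + η • x
      = dotV v c ∧ resolventSq A v η c = ‖x‖ ^ 2 := by
  set N := dotA A c - lamM (dotA A c) • (1 : Matrix (Fin n) (Fin n) 𝕜) + η • 1 with hN
  have hNx : ∀ x, opCLM N x
      = (opCLM (dotA A c) + shift (opCLM (dotA A c)) • ContinuousLinearMap.id ℝ (EuclideanSpace 𝕜 (Fin n))) x + η • x := by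
    intro x
    rw [shift_opCLM (isHermitian_dotA hA c), hN, map_add, map_sub, map_smul, map_smul]
    simp only [add_apply, sub_apply, smul_apply, opCLM_one, neg_smul, ContinuousLinearMap.id_apply]
    simp [sub_eq_add_neg]
  have hdet : IsUnit N.det := by
    refine (isUnit_det_iff N).2 fun x hx => ?_
    rw [hNx] at hx
    have h1 := norm_mul_le_of_map_add_smul_eq (psd_add_shift (opCLM (dotA A c))) hx
    rw [norm_zero] at h1
    exact norm_le_zero_iff.1 (nonpos_of_mul_nonpos_right h1 hη)
  refine ⟨opCLM N⁻¹ (dotV v c), ?_, rfl⟩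
  rw [← hNx, ← opCLM_mul, Matrix.mul_nonsing_inv N hdet, opCLM_one]

theorem resolventSq_nonneg (η : ℝ) (c : EuclideanSpace ℝ (Fin m)) : 0 ≤ resolventSq A v η c :=
  sq_nonneg _

theorem bddBelow_resolventSq (η : ℝ) : BddBelow (Set.range
    fun c : sphere (0 : EuclideanSpace ℝ (Fin m)) 1 => resolventSq A v η c) :=
  ⟨0, by rintro _ ⟨c, rfl⟩; exact resolventSq_nonneg η _⟩

theorem antitoneOn_minResolventSq [NeZero n] (hA : ∀ i, (A i).IsHermitian) :
    AntitoneOn (fun η : ℝ => ENNReal.ofReal (minResolventSq A v η)) (Set.Ioi 0) := by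
  intro η hη η' hη' hle
  refine ENNReal.ofReal_le_ofReal (ciInf_mono (bddBelow_resolventSq _) fun c => ?_)
  rcases hle.eq_or_lt with rfl | hlt
  · exact le_rfl
  obtain ⟨x, hx, hx'⟩ := resolventSq_spec hA v hη (c : EuclideanSpace ℝ (Fin m))
  obtain ⟨y, hy, hy'⟩ := resolventSq_spec hA v hη' (c : EuclideanSpace ℝ (Fin m))
  rw [hx', hy']
  set N := opCLM (dotA A c) + shift (opCLM (dotA A c)) •
    ContinuousLinearMap.id ℝ (EuclideanSpace 𝕜 (Fin n))
  have hN : ∀ x, 0 ≤ ⟪N x, x⟫ := psd_add_shift _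
  have hxy : ‖y‖ ≤ ‖x‖ := by
    refine norm_le_of_map_add_smul_eq (N := N + η • ContinuousLinearMap.id ℝ _) (fun z => ?_)
      (sub_pos.2 hlt) ?_
    · have h1 : 0 ≤ η * ‖z‖ ^ 2 := mul_nonneg (le_of_lt hη) (sq_nonneg _)
      have h2 := hN z
      simp only [add_apply, smul_apply, ContinuousLinearMap.id_apply, inner_add_left,
        inner_smul_left, conj_trivial, real_inner_self_eq_norm_sq] at h1 h2 ⊢
      linarith
    · have h1 := hy.trans hx.symm
      simp only [add_apply N, smul_apply, ContinuousLinearMap.id_apply]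
      rw [← h1]
      module
  gcongr

theorem tendsto_minResolventSq [NeZero n] (hA : ∀ i, (A i).IsHermitian) :
    Tendsto (fun η : ℝ => ENNReal.ofReal (minResolventSq A v η)) (𝓝[>] 0)
      (𝓝 (sSup ((fun η : ℝ => ENNReal.ofReal (minResolventSq A v η)) '' Set.Ioi 0))) :=
  (antitoneOn_minResolventSq hA).tendsto_nhdsGT (OrderTop.bddAbove _)

theorem epsMaxSq_eq [NeZero n] (hA : ∀ i, (A i).IsHermitian) : epsMaxSq A v
    = sSup ((fun η : ℝ => ENNReal.ofReal (minResolventSq A v η)) '' Set.Ioi 0) :=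
  (tendsto_minResolventSq hA).limUnder_eq

/-- A degenerate point for c bounds the resolvent norm at c for every η. Conversely, if the supremum
over η is at most ε², near-minimizing c for each η produce in the limit a degenerate point in the
closed ball. -/
theorem ofReal_sq_lt_epsMaxSq_iff [NeZero n] [NeZero m] (hA : ∀ i, (A i).IsHermitian) {ε : ℝ}
    (hε : 0 ≤ ε) :
    ENNReal.ofReal (ε ^ 2) < epsMaxSq A v ↔ (family A v hA).StrictlyAdmissible ε := by
  rw [epsMaxSq_eq hA]
  constructor
  · intro h c hc x hx
    obtain ⟨_, ⟨η, hη, rfl⟩, hlt⟩ := lt_sSup_iff.1 h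
    have h1 : ε ^ 2 < minResolventSq A v η := (ENNReal.ofReal_lt_ofReal_iff_of_nonneg
      (sq_nonneg ε)).1 hlt
    have h2 : minResolventSq A v η ≤ resolventSq A v η c :=
      ciInf_le (bddBelow_resolventSq η)
        (⟨c, mem_sphere_zero_iff_norm.2 hc⟩ : sphere (0 : EuclideanSpace ℝ (Fin m)) 1)
    obtain ⟨y, hy, hy'⟩ := resolventSq_spec hA v hη c
    have h3 : ‖y‖ ≤ ‖x‖ :=
      norm_le_of_map_add_smul_eq (psd_add_shift (opCLM (dotA A c))) hη (hy.trans hx.symm)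
    refine lt_of_lt_of_le (lt_of_pow_lt_pow_left₀ 2 (norm_nonneg y) ?_) h3
    linarith
  · intro h
    by_contra! hle
    have h1 : ∀ η : ℝ, 0 < η → ∃ c ∈ sphere (0 : EuclideanSpace ℝ (Fin m)) 1, ∃ x,
        (opCLM (dotA A c) + shift (opCLM (dotA A c)) • ContinuousLinearMap.id ℝ (EuclideanSpace 𝕜 (Fin n))) x + η • x
          = dotV v c ∧ ‖x‖ ≤ ε + η := by
      intro η hη
      have h2 : ENNReal.ofReal (minResolventSq A v η) ≤ ENNReal.ofReal (ε ^ 2) :=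
        le_trans (le_sSup (Set.mem_image_of_mem
          (fun η : ℝ => ENNReal.ofReal (minResolventSq A v η)) (Set.mem_Ioi.2 hη))) hle
      have h3 : minResolventSq A v η ≤ ε ^ 2 := (ENNReal.ofReal_le_ofReal_iff (sq_nonneg ε)).1 h2
      have h4 : minResolventSq A v η < (ε + η) ^ 2 := h3.trans_lt (by gcongr; linarith)
      have : Nonempty (sphere (0 : EuclideanSpace ℝ (Fin m)) 1) :=
        (NormedSpace.sphere_nonempty.2 zero_le_one).to_subtype
      obtain ⟨c, hc⟩ := exists_lt_of_ciInf_lt h4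
      obtain ⟨x, hx, hx'⟩ := resolventSq_spec hA v hη (c : EuclideanSpace ℝ (Fin m))
      refine ⟨c, c.2, x, hx, ?_⟩
      rw [hx'] at hc
      exact (lt_of_pow_lt_pow_left₀ 2 (by linarith) hc).le
    have hT := (family A v hA).T.continuous
    obtain ⟨c, hc, x, hx, hx'⟩ := exists_solution_of_resolvent
      (isCompact_sphere (0 : EuclideanSpace ℝ (Fin m)) 1)
      (N := fun c => opCLM (dotA A c) + shift (opCLM (dotA A c)) •
        ContinuousLinearMap.id ℝ (EuclideanSpace 𝕜 (Fin n)))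
      (hT.add ((continuous_shift.comp hT).smul continuous_const))
      (family A v hA).w.continuous h1
    exact absurd hx' (not_le.2 (h c (mem_sphere_zero_iff_norm.1 hc) x hx))

theorem ofReal_sq_le_epsMaxSq_iff [NeZero n] [NeZero m] (hA : ∀ i, (A i).IsHermitian) {ε : ℝ}
    (hε : 0 < ε) :
    ENNReal.ofReal (ε ^ 2) ≤ epsMaxSq A v ↔ (family A v hA).Admissible ε := by
  constructor
  · intro h c hc x hx
    by_contra! hlt
    have h1 : ENNReal.ofReal (‖x‖ ^ 2) < epsMaxSq A v := by
      refine lt_of_lt_of_le ?_ h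
      exact (ENNReal.ofReal_lt_ofReal_iff (by positivity)).2 (by gcongr)
    exact lt_irrefl _ ((ofReal_sq_lt_epsMaxSq_iff hA (norm_nonneg x)).1 h1 c hc x hx)
  · intro h
    by_contra! hlt
    obtain ⟨r, hr, hr'⟩ := ENNReal.lt_iff_exists_nnreal_btwn.1 hlt
    have h1 : ENNReal.ofReal (√(r : ℝ) ^ 2) = r := by
      rw [Real.sq_sqrt (NNReal.coe_nonneg r), ENNReal.ofReal_coe_nnreal]
    have h2 : √(r : ℝ) < ε := by
      rw [← h1] at hr'
      exact lt_of_pow_lt_pow_left₀ 2 hε.le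
        ((ENNReal.ofReal_lt_ofReal_iff_of_nonneg (sq_nonneg _)).1 hr')
    have h3 := (ofReal_sq_lt_epsMaxSq_iff (v := v) hA (Real.sqrt_nonneg (r : ℝ))).2
      fun c hc x hx => h2.trans_le (h c hc x hx)
    rw [h1] at h3
    exact lt_asymm hr h3

theorem strictConvex_ballImage [NeZero m] {ε : ℝ} (hε : 0 < ε)
    (h : (family A v hA).Admissible ε) :
    StrictConvex ℝ (ballImage A v ε) ∧ BoundaryFromSphere A v ε := by
  obtain ⟨h1, h2⟩ := h.strictConvex hε
  rw [family_f] at h1 h2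
  refine ⟨h1, fun x hx hfx => ?_, fun x hx => ?_⟩
  · exact mem_sphere_zero_iff_norm.2 (h2 x (mem_closedBall_zero_iff.1 hx) hfx.2)
  · by_contra hint
    rw [mem_ball_zero_iff] at hx
    exact hx.ne (h2 x hx.le hint)

theorem strictlyAdmissible_conclusion [NeZero n] [NeZero m] {ε : ℝ} (hε : 0 < ε)
    (h : (family A v hA).StrictlyAdmissible ε) :
    StronglyConvexSet (ballImage A v ε) ∧ HasSmoothBoundary (ballImage A v ε) ∧
      BoundaryFromSphere A v ε :=
  ⟨h.stronglyConvexSet hε, h.hasSmoothBoundary hε, (strictConvex_ballImage hε h.admissible).2⟩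

/-- The degenerate equation is closed in all its data and c, x range over compact sets, so having no
solution survives small perturbations. -/
theorem eventually_strictlyAdmissible {ε : ℝ} (h : (family A v hA).StrictlyAdmissible ε) :
    ∀ᶠ p in 𝓝 (A, v), ∀ hp : ∀ i, (p.1 i).IsHermitian,
      (family p.1 p.2 hp).StrictlyAdmissible ε := by
  have key : ∀ᶠ p in 𝓝 (A, v), ∀ k ∈ sphere (0 : EuclideanSpace ℝ (Fin m)) 1 ×ˢ
      closedBall (0 : EuclideanSpace 𝕜 (Fin n)) ε,
      opCLM (dotA p.1 k.1) k.2 + shift (opCLM (dotA p.1 k.1)) • k.2 ≠ dotV p.2 k.1 := by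
    refine ((isCompact_sphere _ _).prod
      (isCompact_closedBall _ _)).eventually_forall_of_forall_eventually ?_
    rintro ⟨c, x⟩ ⟨hc, hx⟩
    have hT : Continuous fun b : ((Fin m → Matrix (Fin n) (Fin n) 𝕜) ×
        (Fin m → EuclideanSpace 𝕜 (Fin n))) × EuclideanSpace ℝ (Fin m) × EuclideanSpace 𝕜 (Fin n) =>
        opCLM (dotA b.1.1 b.2.1) := by
      refine continuous_opCLM.comp ?_
      unfold dotA
      refine continuous_finsetSum _ fun i _ => ?_
      fun_prop
    have hclosed : IsClosed {b : ((Fin m → Matrix (Fin n) (Fin n) 𝕜) ×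
        (Fin m → EuclideanSpace 𝕜 (Fin n))) × EuclideanSpace ℝ (Fin m) × EuclideanSpace 𝕜 (Fin n) |
        opCLM (dotA b.1.1 b.2.1) b.2.2 + shift (opCLM (dotA b.1.1 b.2.1)) • b.2.2
          = dotV b.1.2 b.2.1} := by
      refine isClosed_eq ((hT.clm_apply (by fun_prop)).add
        ((continuous_shift.comp hT).smul (by fun_prop))) ?_
      unfold dotV
      fun_prop
    refine hclosed.isOpen_compl.mem_nhds fun h0 => ?_
    exact absurd (mem_closedBall_zero_iff.1 hx)
      (not_le.2 (h c (mem_sphere_zero_iff_norm.1 hc) x h0))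
  filter_upwards [key] with p hp hph c hc x hx
  by_contra! hle
  exact hp (c, x) ⟨mem_sphere_zero_iff_norm.2 hc, mem_closedBall_zero_iff.2 hle⟩ hx

end

/-! ### Comparison with Polyak's bound -/

section Polyak

variable (A : Fin m → Matrix (Fin n) (Fin n) 𝕜) (v : Fin m → EuclideanSpace 𝕜 (Fin n))

theorem inner_opCLM_dotA (c : EuclideanSpace ℝ (Fin m)) (x y : EuclideanSpace 𝕜 (Fin n)) :
    ⟪x, opCLM (dotA A c) y⟫ = ∑ i, c i * ⟪x, opCLM (A i) y⟫ := by
  simp [opCLM_dotA, sum_apply, inner_sum, inner_smul_right]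

theorem lipConst_nonneg : 0 ≤ lipConst A :=
  Real.iSup_nonneg fun _ => Real.sqrt_nonneg _

theorem inner_opCLM_dotA_le_lipConst {c : EuclideanSpace ℝ (Fin m)} (hc : ‖c‖ = 1)
    {x y : EuclideanSpace 𝕜 (Fin n)} (hx : ‖x‖ = 1) (hy : ‖y‖ = 1) :
    ⟪x, opCLM (dotA A c) y⟫ ≤ lipConst A := by
  have hcont : Continuous fun p : sphere (0 : EuclideanSpace 𝕜 (Fin n)) 1 ×
      sphere (0 : EuclideanSpace 𝕜 (Fin n)) 1 =>
      √(∑ i, ⟪(p.1 : EuclideanSpace 𝕜 (Fin n)), opCLM (A i) p.2⟫ ^ 2) := by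
    refine Real.continuous_sqrt.comp (continuous_finsetSum _ fun i _ => ?_)
    fun_prop
  have h1 : √(∑ i, ⟪x, opCLM (A i) y⟫ ^ 2) ≤ lipConst A := by
    have h2 := le_ciSup (isCompact_range hcont).bddAbove
      (⟨x, mem_sphere_zero_iff_norm.2 hx⟩, ⟨y, mem_sphere_zero_iff_norm.2 hy⟩)
    simp_rw [real_inner_eq_re] at h2 ⊢
    exact h2
  refine le_trans ?_ h1
  have h3 := real_inner_le_norm c (WithLp.toLp 2 fun i => ⟪x, opCLM (A i) y⟫)
  rw [hc, one_mul, EuclideanSpace.norm_eq] at h3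
  rw [inner_opCLM_dotA]
  simpa [PiLp.inner_apply, mul_comm] using h3

theorem norm_opCLM_dotA_le {c : EuclideanSpace ℝ (Fin m)} (hc : ‖c‖ = 1)
    (x : EuclideanSpace 𝕜 (Fin n)) : ‖opCLM (dotA A c) x‖ ≤ lipConst A * ‖x‖ := by
  set y := opCLM (dotA A c) x with hy
  rcases eq_or_ne y 0 with h0 | h0
  · rw [h0, norm_zero]
    exact mul_nonneg (lipConst_nonneg A) (norm_nonneg x)
  have hx0 : x ≠ 0 := by
    rintro rfl
    exact h0 (by rw [hy, map_zero])
  have hxp : 0 < ‖x‖ := norm_pos_iff.2 hx0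
  have hyp : 0 < ‖y‖ := norm_pos_iff.2 h0
  have h1 := inner_opCLM_dotA_le_lipConst A hc (x := ‖y‖⁻¹ • y) (y := ‖x‖⁻¹ • x)
    (by simp [norm_smul, hyp.ne']) (by simp [norm_smul, hxp.ne'])
  rw [map_smul, ← hy, inner_smul_left, inner_smul_right, real_inner_self_eq_norm_sq,
    conj_trivial] at h1
  have h2 : ‖y‖⁻¹ * (‖x‖⁻¹ * ‖y‖ ^ 2) = ‖y‖ / ‖x‖ := by field_simp
  rwa [h2, div_le_iff₀ hxp] at h1

theorem shift_opCLM_dotA_le [NeZero n] {c : EuclideanSpace ℝ (Fin m)} (hc : ‖c‖ = 1) :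
    shift (opCLM (dotA A c)) ≤ lipConst A := by
  refine shift_le (lipConst_nonneg A) fun x => ?_
  have h1 := abs_real_inner_le_norm (opCLM (dotA A c) x) x
  have h2 := mul_le_mul_of_nonneg_right (norm_opCLM_dotA_le A hc x) (norm_nonneg x)
  have h3 := neg_abs_le ⟪opCLM (dotA A c) x, x⟫
  linarith

theorem nuSq_le_norm_dotV_sq [NeZero m] {c : EuclideanSpace ℝ (Fin m)} (hc : ‖c‖ = 1) :
    nuSq v ≤ ‖dotV v c‖ ^ 2 := by
  set G := Matrix.of fun i j : Fin m => (RCLike.re (inner 𝕜 (v i) (v j)) : ℝ) with hG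
  have hGh : G.IsHermitian := by
    ext i j
    simp only [hG, Matrix.conjTranspose_apply, Matrix.of_apply, ← real_inner_eq_re, star_trivial]
    exact real_inner_comm _ _
  have h1 := (lamMin_spec hGh).1 c
  rw [hc, one_pow, mul_one] at h1
  refine h1.trans_eq ?_
  rw [← real_inner_self_eq_norm_sq, dotV, sum_inner, PiLp.inner_apply]
  refine Finset.sum_congr rfl fun i _ => ?_
  rw [inner_smul_left, inner_sum, conj_trivial]
  simp only [opCLM_apply, Matrix.toLpLin_apply, Matrix.mulVec, dotProduct, inner_smul_right,
    real_inner_eq_re, hG, Matrix.of_apply, RCLike.inner_apply, conj_trivial]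
  congr 1
  exact Finset.sum_congr rfl fun j _ => mul_comm _ _

variable {A v}

/-- For a degenerate point x one has ν ≤ |c·v| = |(c·A + μ)x| ≤ 2L|x|, so |x|² is at least Polyak's
bound. -/
theorem polyakSq_le_epsMaxSq [NeZero n] [NeZero m] (hA : ∀ i, (A i).IsHermitian) :
    polyakSq A v ≤ epsMaxSq A v := by
  by_contra! hlt
  obtain ⟨r, hr, hr'⟩ := ENNReal.lt_iff_exists_nnreal_btwn.1 hlt
  have h1 : ENNReal.ofReal (√(r : ℝ) ^ 2) = r := by
    rw [Real.sq_sqrt (NNReal.coe_nonneg r), ENNReal.ofReal_coe_nnreal]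
  have h2 : ¬ (family A v hA).StrictlyAdmissible √(r : ℝ) := by
    rw [← ofReal_sq_lt_epsMaxSq_iff hA (Real.sqrt_nonneg _), h1]
    exact hr.not_gt
  simp only [QuadFamily.StrictlyAdmissible, not_forall, not_lt, family_T, family_w] at h2
  obtain ⟨c, hc, x, hx, hxr⟩ := h2
  have h3 : ‖dotV v c‖ ≤ 2 * lipConst A * ‖x‖ := by
    rw [← hx]
    refine (norm_add_le _ _).trans ?_
    rw [norm_smul, Real.norm_of_nonneg (shift_nonneg _)]
    have := norm_opCLM_dotA_le A hc x
    have := mul_le_mul_of_nonneg_right (shift_opCLM_dotA_le A hc) (norm_nonneg x)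
    linarith
  have h4 : nuSq v ≤ ‖x‖ ^ 2 * (4 * lipConst A ^ 2) :=
    calc nuSq v ≤ ‖dotV v c‖ ^ 2 := nuSq_le_norm_dotV_sq v hc
      _ ≤ (2 * lipConst A * ‖x‖) ^ 2 := by gcongr
      _ = _ := by ring
  have h5 : polyakSq A v ≤ ENNReal.ofReal (‖x‖ ^ 2) := by
    refine ENNReal.div_le_of_le_mul ?_
    rw [← ENNReal.ofReal_mul (sq_nonneg _)]
    exact ENNReal.ofReal_le_ofReal h4
  have h6 : ENNReal.ofReal (‖x‖ ^ 2) ≤ r := by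
    rw [← h1]
    exact ENNReal.ofReal_le_ofReal (by gcongr)
  exact absurd hr' (not_lt.2 (h5.trans h6))

end Polyak

/-! ### Degenerate points inside the ball -/

theorem notMem_interior_of_forall_inner_le {V : Type*} [NormedAddCommGroup V]
    [InnerProductSpace ℝ V] {F : Set V} {c y : V} (hc : c ≠ 0)
    (h : ∀ z ∈ F, ⟪c, y⟫ ≤ ⟪c, z⟫) : y ∉ interior F := by
  intro hy
  have hcont : ContinuousAt (fun t : ℝ => y - t • c) 0 := by fun_prop
  have h1 : ∀ᶠ t in 𝓝 (0 : ℝ), y - t • c ∈ F :=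
    hcont.eventually_mem (by simpa using mem_interior_iff_mem_nhds.1 hy)
  obtain ⟨t, ht, ht'⟩ := ((h1.filter_mono nhdsWithin_le_nhds).and
    (self_mem_nhdsWithin : Set.Ioi (0 : ℝ) ∈ 𝓝[>] 0)).exists
  have h2 := h _ ht
  rw [inner_sub_right, inner_smul_right, real_inner_self_eq_norm_sq] at h2
  have h3 : 0 < t * ‖c‖ ^ 2 := mul_pos ht' (by positivity)
  linarith

theorem opCLM_smul (M : Matrix (Fin n) (Fin n) 𝕜) (z : 𝕜) (x : EuclideanSpace 𝕜 (Fin n)) :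
    opCLM M (z • x) = z • opCLM M x := by
  rw [opCLM_apply, map_smul, opCLM_apply]

theorem real_inner_smul_smul (z : 𝕜) (x y : EuclideanSpace 𝕜 (Fin n)) :
    ⟪z • x, z • y⟫ = ‖z‖ ^ 2 * ⟪x, y⟫ := by
  rw [real_inner_eq_re, real_inner_eq_re, inner_smul_left, inner_smul_right, ← mul_assoc,
    RCLike.conj_mul, ← RCLike.ofReal_pow, RCLike.re_ofReal_mul]

theorem real_inner_smul_eq_zero {x u : EuclideanSpace 𝕜 (Fin n)} (h : inner 𝕜 u x = 0) (z : 𝕜) :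
    ⟪x, z • u⟫ = 0 := by
  rw [real_inner_eq_re, inner_smul_right, inner_eq_zero_symm.1 h, mul_zero, map_zero]

theorem norm_add_smul_sq {x u : EuclideanSpace 𝕜 (Fin n)} (h : inner 𝕜 u x = 0) (hu : ‖u‖ = 1)
    (z : 𝕜) : ‖x + z • u‖ ^ 2 = ‖x‖ ^ 2 + ‖z‖ ^ 2 := by
  rw [norm_add_sq_real, real_inner_smul_eq_zero h, norm_smul, hu]
  ring

/-- `x₀` solves `(c·A + μ) x₀ = c·v` for a multiplier `μ > 0` that makes `c·A + μ` positive
semidefinite with a unit vector `u ⟂ x₀` in the kernel. -/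
structure Degenerate (A : Fin m → Matrix (Fin n) (Fin n) 𝕜) (v : Fin m → EuclideanSpace 𝕜 (Fin n))
    (c : EuclideanSpace ℝ (Fin m)) (μ : ℝ) (x₀ u : EuclideanSpace 𝕜 (Fin n)) : Prop where
  herm : ∀ i, (A i).IsHermitian
  norm_c : ‖c‖ = 1
  pos : 0 < μ
  norm_u : ‖u‖ = 1
  ortho : inner 𝕜 u x₀ = 0
  psd : ∀ x, 0 ≤ ⟪opCLM (dotA A c) x, x⟫ + μ * ‖x‖ ^ 2
  eq_x : opCLM (dotA A c) x₀ + μ • x₀ = dotV v c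
  eq_u : opCLM (dotA A c) u + μ • u = 0

theorem exists_degenerate [NeZero n] [NeZero m] {A : Fin m → Matrix (Fin n) (Fin n) 𝕜}
    {v : Fin m → EuclideanSpace 𝕜 (Fin n)} (hA : ∀ i, (A i).IsHermitian) {ε : ℝ} (hε : 0 < ε)
    (hlt : epsMaxSq A v < ENNReal.ofReal (ε ^ 2)) (hB : BoundaryFromSphere A v ε) :
    ∃ c μ x₀ u, Degenerate A v c μ x₀ u ∧ ‖x₀‖ < ε := by
  have h1 : ¬ (family A v hA).Admissible ε := by
    rw [← ofReal_sq_le_epsMaxSq_iff hA hε]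
    exact not_le.2 hlt
  simp only [QuadFamily.Admissible, not_forall, not_le] at h1
  obtain ⟨c, hc, x, hx, hxε⟩ := h1
  have hsym := opCLM_symm (isHermitian_dotA hA c)
  -- With zero shift x would minimize c·f globally, and f x could not be interior to the image.
  have hμ : 0 < shift (opCLM (dotA A c)) := by
    refine lt_of_le_of_ne (shift_nonneg _) fun h0 => ?_
    refine notMem_interior_of_forall_inner_le (c := c) (fun h => by simp [h] at hc) ?_
      (hB.2 x (mem_ball_zero_iff.2 hxε))
    rintro _ ⟨y, -, rfl⟩
    have h2 := (family A v hA).inner_sub_eq hx y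
    have h3 := add_shift_nonneg (opCLM (dotA A c)) (y - x)
    rw [family_T, family_f, ← h0] at h2
    rw [← h0] at h3
    linarith
  obtain ⟨u, hu, hu'⟩ := (shift_eq_zero_or (opCLM (dotA A c))).resolve_left hμ.ne'
  rw [family_T, family_w] at hx
  set μ := shift (opCLM (dotA A c))
  have hu0 : opCLM (dotA A c) u + μ • u = 0 :=
    map_eq_zero_of_inner_eq_zero hsym (add_shift_nonneg _) (by rw [hu]; linarith)
  -- Removing the kernel component of x keeps the equation and does not increase the norm.
  have hortho : inner 𝕜 u (x - (inner 𝕜 u x : 𝕜) • u) = 0 := by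
    rw [inner_sub_right, inner_smul_right, inner_self_eq_norm_sq_to_K, hu]
    simp
  refine ⟨c, μ, x - (inner 𝕜 u x : 𝕜) • u, u,
    ⟨hA, hc, hμ, hu, hortho, add_shift_nonneg _, ?_, hu0⟩, ?_⟩
  · rw [map_sub, opCLM_smul, eq_neg_of_add_eq_zero_left hu0, ← hx, smul_sub,
      smul_comm (inner 𝕜 u x : 𝕜) μ u |>.symm, smul_neg]
    abel
  · have h2 := norm_add_smul_sq hortho hu (inner 𝕜 u x)
    rw [sub_add_cancel] at h2
    refine lt_of_le_of_lt ((sq_le_sq₀ (norm_nonneg _) (norm_nonneg x)).1 ?_) hxε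
    nlinarith [sq_nonneg ‖inner 𝕜 u x‖]

/-! ### Perturbations that isolate the kernel direction -/

section Perturbation

variable (u : EuclideanSpace 𝕜 (Fin n))

/-- The matrix of the map `y ↦ y - ⟨u, y⟩ u`. -/
noncomputable def complMatrix : Matrix (Fin n) (Fin n) 𝕜 :=
  Matrix.toEuclideanLin.symm (LinearMap.id - ((innerSL 𝕜 u).smulRight u).toLinearMap)

theorem opCLM_complMatrix (y : EuclideanSpace 𝕜 (Fin n)) :
    opCLM (complMatrix u) y = y - (inner 𝕜 u y : 𝕜) • u := by
  rw [opCLM_apply, complMatrix, LinearEquiv.apply_symm_apply]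
  simp

theorem isHermitian_complMatrix : (complMatrix u).IsHermitian := by
  refine Matrix.isSymmetric_toEuclideanLin_iff.1 fun x y => ?_
  rw [← opCLM_apply, ← opCLM_apply, opCLM_complMatrix, opCLM_complMatrix, inner_sub_left,
    inner_sub_right, inner_smul_left, inner_smul_right, inner_conj_symm, mul_comm]

variable (A : Fin m → Matrix (Fin n) (Fin n) 𝕜) (v : Fin m → EuclideanSpace 𝕜 (Fin n))
  (c : EuclideanSpace ℝ (Fin m)) (x₀ : EuclideanSpace 𝕜 (Fin n)) (b : Fin m → 𝕜) (τ : ℝ)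

/-- Perturbed matrices, for which the kernel of `c·A + μ` shrinks to the line of `u`. -/
noncomputable def pertA (i : Fin m) : Matrix (Fin n) (Fin n) 𝕜 := A i + (τ * c i) • complMatrix u

/-- Perturbed vectors, which keep `x₀` as a solution and tilt the face by `b`. -/
noncomputable def pertV (i : Fin m) : EuclideanSpace 𝕜 (Fin n) :=
  v i + (τ * c i) • x₀ + τ • b i • u

theorem continuous_pert :
    Continuous fun τ : ℝ => (pertA u A c τ, pertV u v c x₀ b τ) := by
  unfold pertA pertV
  fun_prop

theorem pert_zero : (pertA u A c 0, pertV u v c x₀ b 0) = (A, v) := by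
  refine Prod.ext (funext fun i => ?_) (funext fun i => ?_) <;> simp [pertA, pertV]

variable {u A v c x₀ b τ} {μ : ℝ}

theorem sum_coord_sq (hc : ‖c‖ = 1) : ∑ i, c i * c i = 1 := by
  have h := real_inner_self_eq_norm_sq c
  rw [hc, PiLp.inner_apply] at h
  simpa [sq] using h

theorem sum_coord_mul (hc : ‖c‖ = 1) (τ : ℝ) : ∑ i, c i * (τ * c i) = τ := by
  have h : ∀ i, c i * (τ * c i) = τ * (c i * c i) := fun i => by ring
  simp_rw [h]
  rw [← Finset.mul_sum, sum_coord_sq hc, mul_one]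

theorem dotA_pertA (hc : ‖c‖ = 1) : dotA (pertA u A c τ) c = dotA A c + τ • complMatrix u := by
  simp only [dotA, pertA, smul_add, Finset.sum_add_distrib, smul_smul]
  rw [← Finset.sum_smul]
  congr 2
  exact sum_coord_mul hc τ

theorem dotV_pertV (hc : ‖c‖ = 1) (hb : ∑ i, c i • b i = 0) :
    dotV (pertV u v c x₀ b τ) c = dotV v c + τ • x₀ := by
  simp only [dotV, pertV, smul_add, Finset.sum_add_distrib]
  have h1 : ∑ i, c i • τ • b i • u = 0 := by
    have h2 : ∀ i, c i • τ • b i • u = τ • (c i • b i) • u := by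
      intro i
      rw [smul_comm (c i) τ, smul_assoc]
    simp_rw [h2]
    rw [← Finset.smul_sum, ← Finset.sum_smul, hb, zero_smul, smul_zero]
  have h2 : ∑ i, c i • (τ * c i) • x₀ = τ • x₀ := by
    simp_rw [smul_smul]
    rw [← Finset.sum_smul]
    congr 1
    exact sum_coord_mul hc τ
  rw [h1, h2, add_zero]

theorem isHermitian_pertA (hA : ∀ i, (A i).IsHermitian) (i : Fin m) :
    (pertA u A c τ i).IsHermitian := by
  refine (hA i).add ?_
  rw [Matrix.IsHermitian, Matrix.conjTranspose_smul, (isHermitian_complMatrix u).eq]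
  simp

theorem inner_complMatrix_self (hu : ‖u‖ = 1) (y : EuclideanSpace 𝕜 (Fin n)) :
    ⟪opCLM (complMatrix u) y, y⟫ = ‖opCLM (complMatrix u) y‖ ^ 2 := by
  have h1 : inner 𝕜 u (opCLM (complMatrix u) y) = 0 := by
    rw [opCLM_complMatrix, inner_sub_right, inner_smul_right, inner_self_eq_norm_sq_to_K, hu]
    simp
  have h2 : y = opCLM (complMatrix u) y + (inner 𝕜 u y : 𝕜) • u := by
    rw [opCLM_complMatrix]
    abel
  nth_rewrite 2 [h2]
  rw [inner_add_right, real_inner_smul_eq_zero h1, add_zero, real_inner_self_eq_norm_sq]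

theorem inner_dotA_pertA (hc : ‖c‖ = 1) (hu : ‖u‖ = 1) (y : EuclideanSpace 𝕜 (Fin n)) :
    ⟪opCLM (dotA (pertA u A c τ) c) y, y⟫
      = ⟪opCLM (dotA A c) y, y⟫ + τ * ‖opCLM (complMatrix u) y‖ ^ 2 := by
  rw [dotA_pertA hc, map_add, map_smul, add_apply, smul_apply, inner_add_left, inner_smul_left,
    inner_complMatrix_self hu, conj_trivial]

/-- The added projection is positive semidefinite, kills u and fixes x₀, and the tilt b does not
contribute to c·v; hence c, μ, x₀ and u all persist. -/
theorem Degenerate.pert (h : Degenerate A v c μ x₀ u) (hb : ∑ i, c i • b i = 0) (hτ : 0 ≤ τ) :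
    Degenerate (pertA u A c τ) (pertV u v c x₀ b τ) c μ x₀ u where
  herm := isHermitian_pertA h.herm
  norm_c := h.norm_c
  pos := h.pos
  norm_u := h.norm_u
  ortho := h.ortho
  psd y := by
    rw [inner_dotA_pertA h.norm_c h.norm_u]
    have := h.psd y
    have := mul_nonneg hτ (sq_nonneg ‖opCLM (complMatrix u) y‖)
    linarith
  eq_x := by
    rw [dotA_pertA h.norm_c, dotV_pertV h.norm_c hb, map_add, map_smul, add_apply, smul_apply,
      opCLM_complMatrix, h.ortho, zero_smul, sub_zero, ← h.eq_x]
    abel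
  eq_u := by
    have h1 : opCLM (complMatrix u) u = 0 := by
      rw [opCLM_complMatrix, inner_self_eq_norm_sq_to_K, h.norm_u]
      simp
    rw [dotA_pertA h.norm_c, map_add, map_smul, add_apply, smul_apply, h1, smul_zero, add_zero,
      h.eq_u]

theorem Degenerate.exists_eq_smul_of_pert (h : Degenerate A v c μ x₀ u) (hτ : 0 < τ)
    {y : EuclideanSpace 𝕜 (Fin n)}
    (hy : ⟪opCLM (dotA (pertA u A c τ) c) y, y⟫ + μ * ‖y‖ ^ 2 = 0) : ∃ z : 𝕜, y = z • u := by
  rw [inner_dotA_pertA h.norm_c h.norm_u] at hy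
  have h1 := h.psd y
  have h2 : ‖opCLM (complMatrix u) y‖ ^ 2 = 0 := by
    have h3 := sq_nonneg ‖opCLM (complMatrix u) y‖
    by_contra h4
    have h5 : 0 < τ * ‖opCLM (complMatrix u) y‖ ^ 2 := mul_pos hτ (lt_of_le_of_ne h3 (Ne.symm h4))
    linarith
  have h3 : opCLM (complMatrix u) y = 0 := by simpa using h2
  rw [opCLM_complMatrix, sub_eq_zero] at h3
  exact ⟨_, h3⟩

end Perturbation

/-! ### The face of the image in direction c -/

section Face

variable {A : Fin m → Matrix (Fin n) (Fin n) 𝕜} {v : Fin m → EuclideanSpace 𝕜 (Fin n)}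
  {c : EuclideanSpace ℝ (Fin m)} {μ : ℝ} {x₀ u : EuclideanSpace 𝕜 (Fin n)}

variable (A v x₀ u) in
/-- The part of `z ↦ f(x₀ + z u)` that is linear in `z`, divided by `2`. -/
noncomputable def faceMap : 𝕜 →ₗ[ℝ] EuclideanSpace ℝ (Fin m) where
  toFun z := WithLp.toLp 2 fun i => ⟪opCLM (A i) x₀ - v i, z • u⟫
  map_add' y z := by
    ext i
    simp only [add_smul, inner_add_right, PiLp.add_apply]
  map_smul' r z := by
    ext i
    simp only [smul_assoc, inner_smul_right, PiLp.smul_apply, smul_eq_mul, RingHom.id_apply]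

theorem faceMap_apply (z : 𝕜) (i : Fin m) :
    faceMap A v x₀ u z i = ⟪opCLM (A i) x₀ - v i, z • u⟫ := rfl

theorem quadMap_add_smul (hA : ∀ i, (A i).IsHermitian) (z : 𝕜) :
    quadMap A v (x₀ + z • u) = quadMap A v x₀ + (2 : ℝ) • faceMap A v x₀ u z
      + ‖z‖ ^ 2 • WithLp.toLp 2 fun i => ⟪opCLM (A i) u, u⟫ := by
  ext i
  simp only [PiLp.add_apply, PiLp.smul_apply, smul_eq_mul, faceMap_apply, quadMap_apply,
    ← real_inner_smul_smul, ← opCLM_smul, map_add, inner_add_left, inner_add_right,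
    inner_sub_left]
  rw [opCLM_symm (hA i) (z • u) x₀, real_inner_comm (opCLM (A i) x₀) (z • u)]
  ring

theorem Degenerate.inner_quadMap (h : Degenerate A v c μ x₀ u) (y : EuclideanSpace 𝕜 (Fin n)) :
    ⟪c, quadMap A v y⟫ - ⟪c, quadMap A v x₀⟫ = ⟪opCLM (dotA A c) (y - x₀), y - x₀⟫
      + μ * ‖y - x₀‖ ^ 2 + μ * (‖x₀‖ ^ 2 - ‖y‖ ^ 2) :=
  QuadFamily.inner_sub_eq (Q := family A v h.herm) h.eq_x y

theorem Degenerate.inner_quadMap_add_smul (h : Degenerate A v c μ x₀ u) (z : 𝕜) :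
    ⟪c, quadMap A v (x₀ + z • u)⟫ = ⟪c, quadMap A v x₀⟫ - μ * ‖z‖ ^ 2 := by
  have h1 := h.inner_quadMap (x₀ + z • u)
  rw [norm_add_smul_sq h.ortho h.norm_u, add_sub_cancel_left, opCLM_smul, real_inner_smul_smul,
    eq_neg_of_add_eq_zero_left h.eq_u, inner_neg_left, inner_smul_left,
    real_inner_self_eq_norm_sq, norm_smul, h.norm_u, conj_trivial] at h1
  linarith

/-- The lower bound is the value at x₀ + zu with |z|² = ε² - |x₀|², so all these points minimize c·f
over the ball. -/
theorem Degenerate.le_inner_quadMap (h : Degenerate A v c μ x₀ u) {ε : ℝ}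
    {y : EuclideanSpace 𝕜 (Fin n)} (hy : ‖y‖ ≤ ε) :
    ⟪c, quadMap A v x₀⟫ - μ * (ε ^ 2 - ‖x₀‖ ^ 2) ≤ ⟪c, quadMap A v y⟫ := by
  have h1 := h.inner_quadMap y
  have h2 := h.psd (y - x₀)
  have h3 : μ * ‖y‖ ^ 2 ≤ μ * ε ^ 2 := by
    have := h.pos
    gcongr
  linarith

theorem midpoint_quadMap (hA : ∀ i, (A i).IsHermitian) (z : 𝕜) :
    (2⁻¹ : ℝ) • quadMap A v (x₀ + z • u) + (2⁻¹ : ℝ) • quadMap A v (x₀ + (-z) • u)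
      = quadMap A v x₀ + ‖z‖ ^ 2 • WithLp.toLp 2 fun i => ⟪opCLM (A i) u, u⟫ := by
  rw [quadMap_add_smul hA, quadMap_add_smul hA, map_neg, norm_neg]
  module

theorem Degenerate.add_smul_mem (h : Degenerate A v c μ x₀ u) {ε : ℝ} (hε : 0 ≤ ε) {z : 𝕜}
    (hz : ‖z‖ ^ 2 = ε ^ 2 - ‖x₀‖ ^ 2) : quadMap A v (x₀ + z • u) ∈ ballImage A v ε := by
  refine ⟨_, mem_closedBall_zero_iff.2 ((sq_le_sq₀ (norm_nonneg _) hε).1 ?_), rfl⟩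
  rw [norm_add_smul_sq h.ortho h.norm_u, hz]
  linarith

/-- The images for z and -z have as midpoint the centre of the affine image of the sphere. A
preimage of the midpoint would minimize c·f, hence be x₀ + tu with |t| = |z| and `faceMap` zero at
t, contradicting injectivity. -/
theorem Degenerate.not_convex (h : Degenerate A v c μ x₀ u) {ε : ℝ} (hε : 0 ≤ ε) (hx₀ : ‖x₀‖ < ε)
    (hker : ∀ y, ⟪opCLM (dotA A c) y, y⟫ + μ * ‖y‖ ^ 2 = 0 → ∃ z : 𝕜, y = z • u)
    (hinj : Function.Injective (faceMap A v x₀ u)) : ¬ Convex ℝ (ballImage A v ε) := by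
  intro hconv
  have hr : 0 < ε ^ 2 - ‖x₀‖ ^ 2 := by nlinarith [norm_nonneg x₀]
  set z : 𝕜 := ((√(ε ^ 2 - ‖x₀‖ ^ 2) : ℝ) : 𝕜) with hzdef
  have hz : ‖z‖ ^ 2 = ε ^ 2 - ‖x₀‖ ^ 2 := by
    rw [hzdef, RCLike.norm_ofReal, sq_abs, Real.sq_sqrt hr.le]
  obtain ⟨y, hy, hyC⟩ := hconv (h.add_smul_mem hε hz) (h.add_smul_mem hε (z := -z) (by simpa))
    (a := 2⁻¹) (b := 2⁻¹) (by norm_num) (by norm_num) (by norm_num)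
  rw [mem_closedBall_zero_iff] at hy
  have h1 : ⟪c, quadMap A v y⟫ = ⟪c, quadMap A v x₀⟫ - μ * (ε ^ 2 - ‖x₀‖ ^ 2) := by
    rw [hyC, inner_add_right, inner_smul_right, inner_smul_right, h.inner_quadMap_add_smul,
      h.inner_quadMap_add_smul, norm_neg, hz]
    ring
  have h2 := h.inner_quadMap y
  have h3 := h.psd (y - x₀)
  have h4 : μ * ‖y‖ ^ 2 ≤ μ * ε ^ 2 := by
    have := h.pos
    gcongr
  obtain ⟨t, ht⟩ := hker (y - x₀) (by linarith)
  have hyt : y = x₀ + t • u := by rw [← ht]; abel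
  have h5 : ‖t‖ ^ 2 = ε ^ 2 - ‖x₀‖ ^ 2 := by
    rw [hyt, h.inner_quadMap_add_smul] at h1
    have := h.pos
    refine mul_left_cancel₀ this.ne' (by linarith)
  rw [midpoint_quadMap h.herm, hz, hyt, quadMap_add_smul h.herm, h5] at hyC
  have h6 : (2 : ℝ) • faceMap A v x₀ u t = 0 := by
    have := congrArg (fun V => V - quadMap A v x₀ - (ε ^ 2 - ‖x₀‖ ^ 2) •
      WithLp.toLp 2 fun i => ⟪opCLM (A i) u, u⟫) hyC
    rw [← sub_eq_zero] at this
    rw [← this]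
    abel
  have h7 : faceMap A v x₀ u t = faceMap A v x₀ u 0 := by
    rw [map_zero]
    simpa using h6
  rw [hinj h7, norm_zero] at h5
  linarith [h5]

/-- Two antipodal points of the face are distinct, and their midpoint lies on the supporting
hyperplane, hence is not interior. -/
theorem Degenerate.not_strictConvex (h : Degenerate A v c μ x₀ u) {ε : ℝ} (hε : 0 ≤ ε)
    (hx₀ : ‖x₀‖ < ε) {z : 𝕜} (hz0 : faceMap A v x₀ u z ≠ 0) :
    ¬ StrictConvex ℝ (ballImage A v ε) := by
  intro hconv
  have hr : 0 < ε ^ 2 - ‖x₀‖ ^ 2 := by nlinarith [norm_nonneg x₀]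
  have hzpos : 0 < ‖z‖ := norm_pos_iff.2 (by rintro rfl; exact hz0 (map_zero _))
  set s : ℝ := √(ε ^ 2 - ‖x₀‖ ^ 2) / ‖z‖
  have hspos : 0 < s := div_pos (Real.sqrt_pos.2 hr) hzpos
  have hs : ‖s • z‖ ^ 2 = ε ^ 2 - ‖x₀‖ ^ 2 := by
    rw [norm_smul, Real.norm_of_nonneg hspos.le, div_mul_cancel₀ _ hzpos.ne', Real.sq_sqrt hr.le]
  have hne : quadMap A v (x₀ + (s • z) • u) ≠ quadMap A v (x₀ + (-(s • z)) • u) := by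
    rw [quadMap_add_smul h.herm, quadMap_add_smul h.herm, map_neg, norm_neg, map_smul]
    intro heq
    have h1 : (4 * s) • faceMap A v x₀ u z = 0 := by
      rw [← sub_eq_zero] at heq
      rw [← heq]
      module
    rcases smul_eq_zero.1 h1 with h2 | h2
    · linarith
    · exact hz0 h2
  have hint := hconv (h.add_smul_mem hε hs) (h.add_smul_mem hε (z := -(s • z)) (by simpa using hs))
    hne (a := 2⁻¹) (b := 2⁻¹) (by norm_num) (by norm_num) (by norm_num)
  refine notMem_interior_of_forall_inner_le (c := c)
    (fun hc => by simpa [hc] using h.norm_c) ?_ hint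
  rintro _ ⟨y, hy, rfl⟩
  rw [inner_add_right, inner_smul_right, inner_smul_right, h.inner_quadMap_add_smul,
    h.inner_quadMap_add_smul, norm_neg, hs]
  have := h.le_inner_quadMap (mem_closedBall_zero_iff.1 hy)
  linarith

end Face

/-! ### Choice of a generic tilt -/

section Generic

variable {A : Fin m → Matrix (Fin n) (Fin n) 𝕜} {v : Fin m → EuclideanSpace 𝕜 (Fin n)}
  {c : EuclideanSpace ℝ (Fin m)} {μ : ℝ} {x₀ u : EuclideanSpace 𝕜 (Fin n)}

/-- A linear map into `c^⟂` can be realized as the change of the face under a perturbation. -/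
theorem Degenerate.exists_tilt (h : Degenerate A v c μ x₀ u)
    (g : 𝕜 →ₗ[ℝ] EuclideanSpace ℝ (Fin m)) (hg : ∀ z, ⟪c, g z⟫ = 0) :
    ∃ b : Fin m → 𝕜, ∑ i, c i • b i = 0 ∧
      ∀ τ : ℝ, faceMap (pertA u A c τ) (pertV u v c x₀ b τ) x₀ u = faceMap A v x₀ u - τ • g := by
  -- Riesz representation of the coordinates of g; that g takes values in c^⟂ turns into ∑ c_i b_i =
  -- 0.
  have hex : ∀ i, ∃ b : 𝕜, ∀ z : 𝕜, ⟪b, z⟫ = g z i := fun i =>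
    ⟨(InnerProductSpace.toDual ℝ 𝕜).symm (LinearMap.toContinuousLinearMap
      ((EuclideanSpace.proj i : EuclideanSpace ℝ (Fin m) →L[ℝ] ℝ).toLinearMap ∘ₗ g)),
      fun z => by simp⟩
  choose b hb using hex
  refine ⟨b, ?_, fun τ => ?_⟩
  · refine ext_inner_right ℝ fun z => ?_
    rw [sum_inner, inner_zero_left, ← hg z, PiLp.inner_apply]
    refine Finset.sum_congr rfl fun i _ => ?_
    rw [inner_smul_left, hb]
    simp [mul_comm]
  · ext z i
    have h1 : ⟪b i • u, z • u⟫ = g z i := by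
      rw [real_inner_eq_re, inner_smul_left, inner_smul_right, inner_self_eq_norm_sq_to_K,
        h.norm_u, ← hb i z, real_inner_eq_re_inner 𝕜, RCLike.inner_apply]
      simp [mul_comm]
    rw [faceMap_apply, pertA, pertV, map_add, map_smul, add_apply, smul_apply, opCLM_complMatrix,
      h.ortho, zero_smul, sub_zero]
    simp only [inner_sub_left, inner_add_left, inner_smul_left, conj_trivial,
      real_inner_smul_eq_zero h.ortho, h1, LinearMap.sub_apply, LinearMap.smul_apply,
      PiLp.sub_apply, PiLp.smul_apply, faceMap_apply, smul_eq_mul]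
    ring

theorem finrank_orthogonal_of_norm_eq_one (hc : ‖c‖ = 1) :
    Module.finrank ℝ (ℝ ∙ c)ᗮ + 1 = m := by
  have h1 := Submodule.finrank_add_finrank_orthogonal (ℝ ∙ c)
  rw [finrank_span_singleton (fun h => by simp [h] at hc), finrank_euclideanSpace_fin] at h1
  omega

theorem eventually_notMem_of_finite {S : Set ℝ} (hS : S.Finite) : ∀ᶠ τ in 𝓝[>] (0 : ℝ), τ ∉ S := by
  have h1 : (S \ {0})ᶜ ∈ 𝓝 (0 : ℝ) :=
    (hS.subset Set.sdiff_subset).isClosed.isOpen_compl.mem_nhds (by simp)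
  filter_upwards [mem_nhdsWithin_of_mem_nhds h1, self_mem_nhdsWithin] with τ h2 h3 h4
  exact h2 ⟨h4, (ne_of_gt h3 : τ ≠ 0)⟩

/-- A stable property holds for some small perturbation with parameter outside a finite set. -/
theorem Degenerate.exists_pert (h : Degenerate A v c μ x₀ u)
    {P : (Fin m → Matrix (Fin n) (Fin n) 𝕜) → (Fin m → EuclideanSpace 𝕜 (Fin n)) → Prop}
    (hP : Stably P A v) (b : Fin m → 𝕜) {S : Set ℝ} (hS : S.Finite) :
    ∃ τ : ℝ, 0 < τ ∧ τ ∉ S ∧ P (pertA u A c τ) (pertV u v c x₀ b τ) := by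
  have h1 : ∀ᶠ τ in 𝓝 (0 : ℝ), (∀ i, (pertA u A c τ i).IsHermitian) →
      P (pertA u A c τ) (pertV u v c x₀ b τ) := by
    have hcont := (continuous_pert u A v c x₀ b).tendsto 0
    rw [pert_zero] at hcont
    exact hcont.eventually hP
  obtain ⟨τ, h2, h3, h4⟩ := ((h1.filter_mono nhdsWithin_le_nhds).and
    ((eventually_notMem_of_finite hS).and self_mem_nhdsWithin)).exists
  exact ⟨τ, h4, h3, h2 (isHermitian_pertA h.herm)⟩

/-- The dimension bound lets 𝕜 embed linearly into c^⟂ by some g. With a left inverse p of g,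
`faceMap` - τg can fail to be injective only if τ is an eigenvalue of p ∘ `faceMap`, which excludes
finitely many τ. -/
theorem Degenerate.not_stably_convex (h : Degenerate A v c μ x₀ u) {ε : ℝ} (hε : 0 ≤ ε)
    (hx₀ : ‖x₀‖ < ε) (hm : Module.finrank ℝ 𝕜 < m) :
    ¬ Stably (fun A' v' => Convex ℝ (ballImage A' v' ε)) A v := by
  intro hP
  have hfr := finrank_orthogonal_of_norm_eq_one h.norm_c
  obtain ⟨g₀, hg₀⟩ := finrank_le_iff_exists_linearMap.1
    (show Module.finrank ℝ 𝕜 ≤ Module.finrank ℝ (ℝ ∙ c)ᗮ by omega)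
  set g : 𝕜 →ₗ[ℝ] EuclideanSpace ℝ (Fin m) := (ℝ ∙ c)ᗮ.subtype ∘ₗ g₀ with hgdef
  have hginj : Function.Injective g := Subtype.val_injective.comp hg₀
  obtain ⟨b, hb, hb'⟩ := h.exists_tilt g fun z =>
    Submodule.mem_orthogonal_singleton_iff_inner_right.1 (g₀ z).2
  obtain ⟨p, hp⟩ := g.exists_leftInverse_of_injective (LinearMap.ker_eq_bot.2 hginj)
  obtain ⟨τ, hτ, hτS, hconv⟩ := h.exists_pert hP b
    (Module.End.finite_hasEigenvalue (p ∘ₗ faceMap A v x₀ u))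
  refine (h.pert hb hτ.le).not_convex hε hx₀ (fun y hy => h.exists_eq_smul_of_pert hτ hy) ?_ hconv
  rw [hb', injective_iff_map_eq_zero]
  intro z hz
  by_contra hz0
  refine hτS (Module.End.hasEigenvalue_of_hasEigenvector (x := z) ⟨?_, hz0⟩)
  rw [Module.End.mem_eigenspace_iff]
  have h1 : p (g z) = z := LinearMap.congr_fun hp z
  have h2 : faceMap A v x₀ u z = τ • g z := sub_eq_zero.1 hz
  rw [LinearMap.comp_apply, h2, map_smul, h1]

/-- A single direction e ⟂ c suffices, available for m ≥ 2: tilting by Re(z)e moves the face map at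
z = 1 along a line, which meets 0 for at most one τ. -/
theorem Degenerate.not_stably_strictConvex (h : Degenerate A v c μ x₀ u) {ε : ℝ} (hε : 0 ≤ ε)
    (hx₀ : ‖x₀‖ < ε) (hm : 2 ≤ m) :
    ¬ Stably (fun A' v' => StrictConvex ℝ (ballImage A' v' ε)) A v := by
  intro hP
  have hfr := finrank_orthogonal_of_norm_eq_one h.norm_c
  have : Nontrivial (ℝ ∙ c)ᗮ := Module.nontrivial_of_finrank_pos (R := ℝ) (by omega)
  obtain ⟨e, he⟩ := exists_ne (0 : (ℝ ∙ c)ᗮ)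
  have he' : (e : EuclideanSpace ℝ (Fin m)) ≠ 0 := by simpa using he
  set g : 𝕜 →ₗ[ℝ] EuclideanSpace ℝ (Fin m) := RCLike.reLm.smulRight e with hgdef
  have hg1 : g 1 = e := by simp [hgdef]
  obtain ⟨b, hb, hb'⟩ := h.exists_tilt g fun z => by
    rw [hgdef, LinearMap.smulRight_apply, inner_smul_right,
      Submodule.mem_orthogonal_singleton_iff_inner_right.1 e.2, mul_zero]
  obtain ⟨τ, hτ, hτS, hconv⟩ := h.exists_pert hP b
    (Set.finite_singleton (⟪faceMap A v x₀ u 1, (e : EuclideanSpace ℝ (Fin m))⟫ /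
      ‖(e : EuclideanSpace ℝ (Fin m))‖ ^ 2))
  refine (h.pert hb hτ.le).not_strictConvex hε hx₀ (z := 1) (fun h0 => hτS ?_) hconv
  rw [hb', LinearMap.sub_apply, sub_eq_zero, LinearMap.smul_apply, hg1] at h0
  have h1 : 0 < ‖(e : EuclideanSpace ℝ (Fin m))‖ := norm_pos_iff.2 he'
  rw [Set.mem_singleton_iff, h0, inner_smul_left, real_inner_self_eq_norm_sq, conj_trivial]
  field_simp

end Generic

end QuadBall

/-! ### Assembly of the theorem -/

theorem proposition1 {𝕜 : Type*} [RCLike 𝕜] {m n : ℕ} (hm : 1 ≤ m) (hn : 1 ≤ n)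
    (A : Fin m → Matrix (Fin n) (Fin n) 𝕜) (hA : ∀ i, (A i).IsHermitian)
    (v : Fin m → EuclideanSpace 𝕜 (Fin n)) :
    -- the limit that defines `ε²_max` exists in `[0, ∞]`
    Tendsto (fun η : ℝ => ENNReal.ofReal (QuadBall.minResolventSq A v η)) (𝓝[>] 0)
      (𝓝 (QuadBall.epsMaxSq A v)) ∧
    -- `ε² < ε²_max`: strong convexity, smoothness, boundary from the sphere
    (∀ ε : ℝ, 0 < ε → ENNReal.ofReal (ε ^ 2) < QuadBall.epsMaxSq A v →
      QuadBall.StronglyConvexSet (QuadBall.ballImage A v ε) ∧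
      QuadBall.HasSmoothBoundary (QuadBall.ballImage A v ε) ∧
      QuadBall.BoundaryFromSphere A v ε) ∧
    -- `ε² = ε²_max`: strict convexity, boundary from the sphere
    (∀ ε : ℝ, 0 < ε → ENNReal.ofReal (ε ^ 2) = QuadBall.epsMaxSq A v →
      StrictConvex ℝ (QuadBall.ballImage A v ε) ∧ QuadBall.BoundaryFromSphere A v ε) ∧
    -- `ε² < ε²_max`: these properties are stable under small perturbations
    (∀ ε : ℝ, 0 < ε → ENNReal.ofReal (ε ^ 2) < QuadBall.epsMaxSq A v →
      QuadBall.Stably (fun A' v' =>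
        QuadBall.StronglyConvexSet (QuadBall.ballImage A' v' ε) ∧
        QuadBall.HasSmoothBoundary (QuadBall.ballImage A' v' ε) ∧
        QuadBall.BoundaryFromSphere A' v' ε) A v) ∧
    -- `ε² > ε²_max`, with `m ≥ 2` over `ℝ` or `m ≥ 3` over `ℂ`: if the boundary still comes from
    -- the sphere, then convexity is destroyed by arbitrarily small perturbations
    (Module.finrank ℝ 𝕜 < m → ∀ ε : ℝ, 0 < ε → QuadBall.epsMaxSq A v < ENNReal.ofReal (ε ^ 2) →
      QuadBall.BoundaryFromSphere A v ε →
      ¬ QuadBall.Stably (fun A' v' => Convex ℝ (QuadBall.ballImage A' v' ε)) A v) ∧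
    -- the same for strict convexity whenever `m ≥ 2`
    (2 ≤ m → ∀ ε : ℝ, 0 < ε → QuadBall.epsMaxSq A v < ENNReal.ofReal (ε ^ 2) →
      QuadBall.BoundaryFromSphere A v ε →
      ¬ QuadBall.Stably (fun A' v' => StrictConvex ℝ (QuadBall.ballImage A' v' ε)) A v) ∧
    -- `ε²_max` improves Polyak's bound
    QuadBall.polyakSq A v ≤ QuadBall.epsMaxSq A v := by
  have : NeZero m := ⟨by omega⟩
  have : NeZero n := ⟨by omega⟩
  refine ⟨?_, fun ε hε h => ?_, fun ε hε h => ?_, fun ε hε h => ?_, fun hm' ε hε h hB => ?_,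
    fun hm' ε hε h hB => ?_, QuadBall.polyakSq_le_epsMaxSq hA⟩
  · rw [QuadBall.epsMaxSq_eq hA]
    exact QuadBall.tendsto_minResolventSq hA
  · exact QuadBall.strictlyAdmissible_conclusion hε
      ((QuadBall.ofReal_sq_lt_epsMaxSq_iff hA hε.le).1 h)
  · exact QuadBall.strictConvex_ballImage hε ((QuadBall.ofReal_sq_le_epsMaxSq_iff hA hε).1 h.le)
  · filter_upwards [QuadBall.eventually_strictlyAdmissible
      ((QuadBall.ofReal_sq_lt_epsMaxSq_iff hA hε.le).1 h)] with p hp hph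
    exact QuadBall.strictlyAdmissible_conclusion hε (hp hph)
  · obtain ⟨c, μ, x₀, u, hdeg, hx₀⟩ := QuadBall.exists_degenerate hA hε h hB
    exact hdeg.not_stably_convex hε.le hx₀ hm'
  · obtain ⟨c, μ, x₀, u, hdeg, hx₀⟩ := QuadBall.exists_degenerate hA hε h hB
    exact hdeg.not_stably_strictConvex hε.le hx₀ hm'
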